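/- Let $J \ge 2$, $\beta_0^* \in \mathbb R$, $\sigma_2^{*2} > 0$. In the one-way random effects model $X_{ij} = \beta_0 + \mu_i + \epsilon_{ij}$ ($i = 1, 2, \dots$; $j = 1,\dots,J$) all $\mu_i \sim N(0,\sigma_1^2)$ and $\epsilon_{ij} \sim N(0,\sigma_2^2)$ are independent; consider testing $\sigma_1^2 = 0$ against $\sigma_1^2 > 0$ on the basis of the groups $\mathbf X_i = (X_{i1},\dots,X_{iJ})^\top$, $i = 1,\dots,N$. Let $\rho(\Sigma) \in \mathbb R^{J(J+1)/2}$ list the upper triangular entries (diagonal included) of a symmetric $J\times J$ matrix $\Sigma$, let $k = J(J+1)/2 + 1$, let $\mathbf 1$ be the all-ones vector in $\mathbb R^J$ and $\mathbf I$ the $J \times J$ identity matrix. Put $$\Theta = \{(\rho(\Sigma), \beta_0) : \Sigma \text{ positive definite},\ \beta_0 \in \mathbb R\} \subset \mathbb R^k,$$ $$\Theta_1 = \{(\rho(\sigma_1^2 \mathbf 1\mathbf 1^\top + \sigma_2^2 \mathbf I), \beta_0) : \sigma_1^2 \ge 0,\ \sigma_2^2 > 0,\ \beta_0 \in \mathbb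 R\},\qquad \Theta_0 = \{(\rho(\sigma_2^2 \mathbf I), \beta_0) : \sigma_2^2 > 0,\ \beta_0 \in \mathbb R\},$$ and for $\theta = (\rho(\Sigma),\beta_0) \in \Theta$ let $P_\theta = N(\beta_0 \mathbf 1, \Sigma)$, with Lebesgue density $p_\theta$. Let $\theta^* = (\rho(\sigma_2^{*2}\mathbf I), \beta_0^*)$, and suppose that the data come from the null model with $\beta_0 = \beta_0^*$, $\sigma_1^2 = 0$, $\sigma_2^2 = \sigma_2^{*2}$, so that $\mathbf X_1, \mathbf X_2, \dots$ are i.i.d. Let $l_N(\theta) = \sum_{i=1}^N \log p_\theta(\mathbf X_i)$ and $$\lambda_N = 2\Big(\sup_{\theta \in \Theta_1} l_N(\theta) - \sup_{\theta \in \Theta_0} l_N(\theta)\Big).$$ For $T \subset \mathbb R^k$ the tangent cone of $T$ at $\theta^*$ is the set of all limits of sequences $\alpha_n(\theta_n - \theta^*)$ with $\alpha_n > 0$, $\theta_n \in T$, $\theta_n \to \theta^*$; let $T_0$, $T_1$ be the tangent cones of $\Theta_0$, $\Theta_1$ at $\theta^*$. Then: 1. In the random effects model with parameters $\beta_0 \in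 \mathbb R$, $\sigma_1^2 \ge 0$, $\sigma_2^2 > 0$ one has $\mathbf X_i \sim N(\beta_0 \mathbf 1, \sigma_1^2 \mathbf 1\mathbf 1^\top + \sigma_2^2 \mathbf I)$. Moreover $\theta^* \in \Theta_0 \subset \Theta_1 \subset \Theta$, $\theta^*$ is an interior point of $\Theta$, and the Fisher information matrix $I(\theta^*)$ of $\{P_\theta : \theta\in\Theta\}$ at $\theta^*$ is positive definite. 2. $T_0 = \{(\rho(b_2 \mathbf I), b_0) : b_0, b_2 \in \mathbb R\}$ and $T_1 = \{(\rho(b_1 \mathbf 1\mathbf 1^\top + b_2 \mathbf I), b_0) : b_1 \ge 0,\ b_0, b_2 \in \mathbb R\}$. With $\mathbf c_0 = (0,\dots,0,1)$, $\mathbf c_1 = (\rho(\mathbf 1\mathbf 1^\top), 0)$, $\mathbf c_2 = (\rho(\mathbf I), 0)$, which are linearly independent, $T_0$ is the 2-dimensional linear subspace spanned by $\mathbf c_0, \mathbf c_2$, and $T_1$ is the half 3-dimensional subspace $\{\alpha_0 \mathbf c_0 + \alpha_1 \mathbf c_1 + \alpha_2 \mathbf c_2 : \alpha_1 \ge 0,\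 \alpha_0, \alpha_2 \in \mathbb R\}$. 3. For every $N \ge 1$, $l_N$ is almost surely bounded above on $\Theta_1$. As $N \to \infty$, $\lambda_N$ converges in distribution to $$\min_{\tau \in T_0} \|\mathbf Z - I(\theta^*)^{1/2}\tau\|^2 - \min_{\tau \in T_1} \|\mathbf Z - I(\theta^*)^{1/2}\tau\|^2,$$ where $\mathbf Z$ is a standard normal random vector in $\mathbb R^k$ (and both minima are attained, for every value of $\mathbf Z$). 4. Let $\mathbf P_0$ be the orthogonal projection onto $T_0$. Then $\mathbf c_1 \ne \mathbf P_0 \mathbf c_1$ and, with $\mathbf v = (\mathbf c_1 - \mathbf P_0 \mathbf c_1)/\|\mathbf c_1 - \mathbf P_0\mathbf c_1\|$, the random variable in 3 equals $(\mathbf v^\top \mathbf Z)^2\, 1_{\{\mathbf v^\top \mathbf Z \ge 0\}}$ for every value of $\mathbf Z$, where $\mathbf v^\top \mathbf Z$ is standard normal. 5. Consequently $\lambda_N$ converges in distribution to $w^2 1_{\{w \ge 0\}}$ with $w$ standard normal, and the law of $w^2 1_{\{w\ge 0\}}$ is the mixture $\tfrac12 \chi^2_0 + \tfrac12 \chi^2_1$,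 where $\chi^2_0$ is the point mass at $0$. -/

import Mathlib

open Set Filter Topology MeasureTheory ProbabilityTheory
open scoped Matrix MatrixOrder RealInnerProductSpace ENNReal NNReal

noncomputable section

namespace RandomEffects

/-- Positions of the upper triangular entries (diagonal included) of a `J × J` matrix. -/
abbrev Upper (J : ℕ) : Type := {p : Fin J × Fin J // p.1 ≤ p.2}

/-- The index set of the coordinates of `(ρ(Σ), β₀)`. It has `J (J + 1) / 2 + 1` elements. -/
abbrev Idx (J : ℕ) : Type := Upper J ⊕ Unit

/-- The parameter vectors of the saturated model, with the Euclidean norm. -/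
abbrev Param (J : ℕ) : Type := EuclideanSpace ℝ (Idx J)

/-- The sample space of one group: vectors `(x₁, …, x_J)`. -/
abbrev Obs (J : ℕ) : Type := EuclideanSpace ℝ (Fin J)

/-- The parameter vector `(ρ(S), b)`, where `ρ` lists the upper triangular entries of `S`. -/
def param {J : ℕ} (S : Matrix (Fin J) (Fin J) ℝ) (b : ℝ) : Param J :=
  WithLp.toLp 2 (Sum.elim (fun p : Upper J => S p.1.1 p.1.2) (fun _ => b))

/-- The symmetric matrix whose upper triangular entries are stored in `θ`. -/
def covOf {J : ℕ} (θ : Param J) : Matrix (Fin J) (Fin J) ℝ :=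
  Matrix.of fun i j => θ (Sum.inl ⟨(min i j, max i j), min_le_max⟩)

/-- The vector `b 1_J`, where `b` is the last entry of `θ`. -/
def meanOf {J : ℕ} (θ : Param J) : Obs J :=
  WithLp.toLp 2 (fun _ => θ (Sum.inr ()))

/-- The matrix `1_J 1_Jᵀ`, all of whose entries are `1`. -/
def onesMat (J : ℕ) : Matrix (Fin J) (Fin J) ℝ := Matrix.of fun _ _ => 1

/-- The matrix `s₁ 1_J 1_Jᵀ + s₂ I_J`. -/
def reCov (J : ℕ) (s₁ s₂ : ℝ) : Matrix (Fin J) (Fin J) ℝ :=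
  s₁ • onesMat J + s₂ • (1 : Matrix (Fin J) (Fin J) ℝ)

/-- The saturated parameter space. -/
def Theta (J : ℕ) : Set (Param J) :=
  {θ | ∃ (S : Matrix (Fin J) (Fin J) ℝ) (b : ℝ), S.PosDef ∧ θ = param S b}

/-- The parameter space under the null hypothesis `σ₁² = 0`. -/
def Theta0 (J : ℕ) : Set (Param J) :=
  {θ | ∃ s₂ b : ℝ, 0 < s₂ ∧ θ = param (s₂ • (1 : Matrix (Fin J) (Fin J) ℝ)) b}

/-- The parameter space of the one-way random effects model. -/
def Theta1 (J : ℕ) : Set (Param J) :=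
  {θ | ∃ s₁ s₂ b : ℝ, 0 ≤ s₁ ∧ 0 < s₂ ∧ θ = param (reCov J s₁ s₂) b}

/-- The density of the normal distribution with mean `meanOf θ` and covariance `covOf θ`. -/
def density {J : ℕ} (θ : Param J) (x : Obs J) : ℝ :=
  (Real.sqrt ((2 * Real.pi) ^ J * (covOf θ).det))⁻¹ *
    Real.exp (-((x - meanOf θ).ofLp ⬝ᵥ ((covOf θ)⁻¹ *ᵥ (x - meanOf θ).ofLp)) / 2)

/-- The distribution `P_θ` of the saturated Gaussian model. -/
def model {J : ℕ} (θ : Param J) : Measure (Obs J) :=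
  multivariateGaussian (meanOf θ) (covOf θ)

/-- The law of one group `(X₁, …, X_J)`, `X_j = b + μ + ε_j`, of the one-way random effects model:
`μ ∼ N(0, v₁)` and `ε_j ∼ N(0, v₂)` are independent. -/
def reLaw (J : ℕ) (b : ℝ) (v₁ v₂ : ℝ≥0) : Measure (Obs J) :=
  ((gaussianReal 0 v₁).prod (Measure.pi fun _ : Fin J => gaussianReal 0 v₂)).map
    (fun q => WithLp.toLp 2 (fun j => b + q.1 + q.2 j))

/-- The log-likelihood of `θ` given the first `N` observations. -/
def logLik {J : ℕ} (N : ℕ) (x : ℕ → Obs J) (θ : Param J) : ℝ :=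
  ∑ i ∈ Finset.range N, Real.log (density θ (x i))

/-- The likelihood ratio statistic of `Θ₀` against `Θ₁`. -/
def lrt {J : ℕ} (N : ℕ) (x : ℕ → Obs J) : ℝ :=
  2 * (sSup (logLik N x '' Theta1 J) - sSup (logLik N x '' Theta0 J))

/-- The tangent cone of `T` at `t`: limits of `αₙ (θₙ - t)` with `αₙ > 0`, `θₙ ∈ T`, `θₙ → t`. -/
def tangentCone {ι : Type*} [Fintype ι] (T : Set (EuclideanSpace ℝ ι)) (t : EuclideanSpace ℝ ι) :
    Set (EuclideanSpace ℝ ι) :=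
  {τ | ∃ (α : ℕ → ℝ) (θ : ℕ → EuclideanSpace ℝ ι),
    (∀ n, 0 < α n) ∧ (∀ n, θ n ∈ T) ∧ Tendsto θ atTop (𝓝 t) ∧
      Tendsto (fun n => α n • (θ n - t)) atTop (𝓝 τ)}

/-- The partial derivative of `θ ↦ log p_θ(x)` in the coordinate `a`. -/
def score {J : ℕ} (θ : Param J) (a : Idx J) (x : Obs J) : ℝ :=
  lineDeriv ℝ (fun η : Param J => Real.log (density η x)) θ (EuclideanSpace.single a 1)

/-- The Fisher information matrix of the saturated model at `θ`. -/
def fisher {J : ℕ} (θ : Param J) : Matrix (Idx J) (Idx J) ℝ :=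
  Matrix.of fun a b => ∫ x, score θ a x * score θ b x ∂(model θ)

/-- The values `‖z - I(θ)^{1/2} τ‖²`, `τ ∈ T`. -/
def sqDists {J : ℕ} (θ : Param J) (T : Set (Param J)) (z : Param J) : Set ℝ :=
  (fun τ => ‖z - Matrix.toEuclideanCLM (𝕜 := ℝ) (CFC.sqrt (fisher θ)) τ‖ ^ 2) '' T

/-- `min_{τ ∈ T₀} ‖z - I(θ)^{1/2} τ‖² - min_{τ ∈ T₁} ‖z - I(θ)^{1/2} τ‖²`, where `T₀`, `T₁` are the
tangent cones of `Θ₀`, `Θ₁` at `θ`. -/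
def limitStat {J : ℕ} (θ : Param J) (z : Param J) : ℝ :=
  sInf (sqDists θ (tangentCone (Theta0 J) θ) z) - sInf (sqDists θ (tangentCone (Theta1 J) θ) z)

/-- `c₀ = (0, …, 0, 1)`. -/
def c0 (J : ℕ) : Param J := param 0 1

/-- `c₁ = (ρ(1_J 1_Jᵀ), 0)`. -/
def c1 (J : ℕ) : Param J := param (onesMat J) 0

/-- `c₂ = (ρ(I_J), 0)`. -/
def c2 (J : ℕ) : Param J := param 1 0

/-- The span of `c₀` and `c₂`. -/
def nullSpan (J : ℕ) : Submodule ℝ (Param J) := Submodule.span ℝ {c0 J, c2 J}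

/-- The difference of `c₁` and its orthogonal projection onto the span of `c₀` and `c₂`. -/
def residual (J : ℕ) : Param J := c1 J - (nullSpan J).starProjection (c1 J)

/-- The normalized residual. -/
def dirV (J : ℕ) : Param J := ‖residual J‖⁻¹ • residual J

/-- The function `w ↦ w² 1{w ≥ 0}`. -/
def posSq (w : ℝ) : ℝ := if 0 ≤ w then w ^ 2 else 0

/-- The `χ²_k` distribution: the law of the sum of the squares of `k` independent standard normal
random variables. -/
def chiSq (k : ℕ) : Measure ℝ :=
  (Measure.pi fun _ : Fin k => gaussianReal 0 1).map (fun z => ∑ i, z i ^ 2)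

end RandomEffects

end

namespace RandomEffects

variable {J : ℕ}

/-! ### Coordinates of the parameter space -/

/-! The limit is obtained by solving the maximization explicitly, not from a general theorem on
likelihood ratios over cones; the geometry of the tangent cones is then matched with the law that
comes out.

Likelihood. The matrix `reCov J s₁ s₂` has eigenvalue `s₂` on vectors with sum zero and `a = s₂ + J
* s₁` on constant vectors. Up to a constant, twice the negative log-likelihood per group is
therefore `(J - 1) * (log s₂ + W / s₂) + log a + (B + J * (m - b) ^ 2) / a`, where `W`, `B`, `m` are
`withinMS`, `betweenMS`, `grandMean`, and the only constraint is `s₂ ≤ a`. If `W ≤ B` the free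
optimum `s₂ = W`, `a = B` is admissible; otherwise the constraint binds and the optimum over
`Theta1` is the pooled one, which lies in `Theta0`. With `x = B / W - 1` the statistic is thus `N *
(J * log (1 + x / J) - log (1 + x))` for `x ≥ 0`, and `0` for `x < 0` (`lrt_eq`).

Asymptotics. To second order this is `N * x ^ 2 * (1 - 1 / J) / 2` (`lrt_eq_posSq`,
`tendsto_quadRatio`). Up to a remainder of order `1 / √N`, `√N * (B - W)` is a normalized i.i.d. sum
of centered variables with variance `2 * J * v ^ 2 / (J - 1)`, while `W` and `B` tend to `v` almost
surely. The central limit theorem and Slutsky's lemma give `posSq w` in the limit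
(`tendstoInDistribution_lrt`).

Geometry. At a scalar covariance matrix the scores are pairwise orthogonal, so the Fisher
information is diagonal (`fisher_eq`), constant on each of the blocks of variances, covariances and
mean. Its square root thus preserves `nullSpan J` and rescales `offDir J = c₁ - c₂`, which is
orthogonal to that span. The images of the tangent cones are a plane and that plane plus a half-line
in direction `dirV J`, and the difference of squared distances is `posSq ⟪dirV J, z⟫`
(`limitStat_eq`). Since `⟪dirV J, z⟫` is standard normal, both descriptions of the limit have the
same law. -/

@[simp] lemma param_inl (S : Matrix (Fin J) (Fin J) ℝ) (b : ℝ) (p : Upper J) :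
    param S b (Sum.inl p) = S p.1.1 p.1.2 := rfl

@[simp] lemma param_inr (S : Matrix (Fin J) (Fin J) ℝ) (b : ℝ) (u : Unit) :
    param S b (Sum.inr u) = b := rfl

lemma param_add (S T : Matrix (Fin J) (Fin J) ℝ) (b c : ℝ) :
    param S b + param T c = param (S + T) (b + c) := by
  ext (p | u) <;> simp

lemma smul_param (r : ℝ) (S : Matrix (Fin J) (Fin J) ℝ) (b : ℝ) :
    r • param S b = param (r • S) (r * b) := by
  ext (p | u) <;> simp

lemma param_sub (S T : Matrix (Fin J) (Fin J) ℝ) (b c : ℝ) :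
    param S b - param T c = param (S - T) (b - c) := by
  ext (p | u) <;> simp

lemma covOf_param {S : Matrix (Fin J) (Fin J) ℝ} (hS : S.IsSymm) (b : ℝ) :
    covOf (param S b) = S := by
  ext i j
  simp only [covOf, Matrix.of_apply, param_inl]
  rcases le_total i j with h | h
  · simp [h]
  · simpa [h] using hS.apply i j

lemma covOf_isSymm (θ : Param J) : (covOf θ).IsSymm := by
  ext i j
  simp [covOf, min_comm, max_comm]

lemma param_covOf (θ : Param J) : param (covOf θ) (θ (Sum.inr ())) = θ := by
  ext (p | u)
  · obtain ⟨⟨i, j⟩, hij⟩ := p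
    have hij' : i ≤ j := hij
    simp [covOf, hij']
  · simp

lemma covOf_add_smul (θ τ : Param J) (t : ℝ) : covOf (θ + t • τ) = covOf θ + t • covOf τ := by
  ext i j
  simp [covOf]

lemma meanOf_param (S : Matrix (Fin J) (Fin J) ℝ) (b : ℝ) :
    meanOf (param S b) = WithLp.toLp 2 (fun _ => b) := rfl

lemma onesMat_apply (i j : Fin J) : onesMat J i j = 1 := rfl

lemma reCov_apply (s₁ s₂ : ℝ) (i j : Fin J) :
    reCov J s₁ s₂ i j = s₁ + if i = j then s₂ else 0 := by
  simp [reCov, onesMat_apply, Matrix.one_apply]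

lemma reCov_isSymm (s₁ s₂ : ℝ) : (reCov J s₁ s₂).IsSymm := by
  ext i j
  simp [reCov_apply, eq_comm]

lemma reCov_zero (s₂ : ℝ) : reCov J 0 s₂ = s₂ • (1 : Matrix (Fin J) (Fin J) ℝ) := by
  simp [reCov]

lemma smul_one_isSymm (s : ℝ) : (s • (1 : Matrix (Fin J) (Fin J) ℝ)).IsSymm := by
  rw [← reCov_zero]; exact reCov_isSymm _ _

lemma posSemidef_onesMat : (onesMat J).PosSemidef := by
  have h := Matrix.posSemidef_vecMulVec_self_star (R := ℝ) (fun _ : Fin J => (1 : ℝ))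
  convert h using 1
  ext i j
  simp [onesMat_apply, Matrix.vecMulVec_apply]

lemma posDef_reCov {s₁ s₂ : ℝ} (h₁ : 0 ≤ s₁) (h₂ : 0 < s₂) : (reCov J s₁ s₂).PosDef :=
  Matrix.PosDef.posSemidef_add (posSemidef_onesMat.smul h₁) (Matrix.PosDef.one.smul h₂)

lemma posSemidef_reCov {s₁ s₂ : ℝ} (h₁ : 0 ≤ s₁) (h₂ : 0 ≤ s₂) : (reCov J s₁ s₂).PosSemidef :=
  (posSemidef_onesMat.smul h₁).add (Matrix.PosSemidef.one.smul h₂)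

/-! ### The parameter spaces -/

lemma theta0_subset_theta1 : Theta0 J ⊆ Theta1 J := by
  rintro _ ⟨s₂, b, hs, rfl⟩
  exact ⟨0, s₂, b, le_rfl, hs, by rw [reCov_zero]⟩

lemma theta1_subset_theta : Theta1 J ⊆ Theta J := by
  rintro _ ⟨s₁, s₂, b, h₁, h₂, rfl⟩
  exact ⟨_, b, posDef_reCov h₁ h₂, rfl⟩

lemma mem_theta_of_posDef_covOf {θ : Param J} (h : (covOf θ).PosDef) : θ ∈ Theta J :=
  ⟨_, _, h, (param_covOf θ).symm⟩

lemma isSymm_of_posDef {S : Matrix (Fin J) (Fin J) ℝ} (h : S.PosDef) : S.IsSymm := by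
  have := h.isHermitian
  rwa [Matrix.IsHermitian, Matrix.conjTranspose_eq_transpose_of_trivial] at this

/-- A symmetric matrix whose entries are close to those of `s I` is positive definite. -/
lemma posDef_of_abs_sub_lt {S : Matrix (Fin J) (Fin J) ℝ} (hS : S.IsSymm) {s ε : ℝ}
    (hε : J * ε < s) (h : ∀ i j, |S i j - (s • (1 : Matrix (Fin J) (Fin J) ℝ)) i j| ≤ ε) :
    S.PosDef := by
  refine Matrix.PosDef.of_dotProduct_mulVec_pos
    (by rwa [Matrix.IsHermitian, Matrix.conjTranspose_eq_transpose_of_trivial]) fun x hx => ?_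
  have hx2 : 0 < ∑ i, x i ^ 2 := by
    obtain ⟨i, hi⟩ : ∃ i, x i ≠ 0 := by
      by_contra! hc
      exact hx (funext hc)
    exact Finset.sum_pos' (fun _ _ => sq_nonneg _) ⟨i, Finset.mem_univ _, by positivity⟩
  -- By `|xᵢ xⱼ| ≤ (xᵢ² + xⱼ²) / 2`, entrywise errors of size `ε` change the quadratic form by at
  -- most `J * ε * ∑ xᵢ²`.
  have key : s * ∑ i, x i ^ 2 - J * ε * ∑ i, x i ^ 2 ≤ ∑ i, ∑ j, x i * (S i j * x j) := by
    have h1 : ∑ i, ∑ j, x i * (S i j * x j) = s * ∑ i, x i ^ 2 +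
        ∑ i, ∑ j, (S i j - (s • (1 : Matrix (Fin J) (Fin J) ℝ)) i j) * (x i * x j) := by
      rw [Finset.mul_sum, ← Finset.sum_add_distrib]
      refine Finset.sum_congr rfl fun i _ => ?_
      have : s * x i ^ 2 = ∑ j, (s • (1 : Matrix (Fin J) (Fin J) ℝ)) i j * (x i * x j) := by
        simp [Matrix.one_apply, sq]
      rw [this, ← Finset.sum_add_distrib]
      exact Finset.sum_congr rfl fun j _ => by ring
    have h2 : ∀ i j, -(ε * ((x i ^ 2 + x j ^ 2) / 2)) ≤
        (S i j - (s • (1 : Matrix (Fin J) (Fin J) ℝ)) i j) * (x i * x j) := fun i j => by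
      have e1 : |x i * x j| ≤ (x i ^ 2 + x j ^ 2) / 2 := by
        rw [abs_le]
        constructor <;> nlinarith [sq_nonneg (x i + x j), sq_nonneg (x i - x j)]
      have e2 := mul_le_mul (h i j) e1 (abs_nonneg _) ((abs_nonneg _).trans (h i j))
      rw [← abs_mul] at e2
      exact (abs_le.1 e2).1
    have h3 : ∑ i : Fin J, ∑ j : Fin J, -(ε * ((x i ^ 2 + x j ^ 2) / 2)) =
        -(J * ε * ∑ i, x i ^ 2) := by
      have : ∀ i : Fin J, ∑ j : Fin J, -(ε * ((x i ^ 2 + x j ^ 2) / 2)) =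
          -(ε / 2) * (J * x i ^ 2 + ∑ j, x j ^ 2) := fun i => by
        rw [mul_add, Finset.mul_sum, show -(ε / 2) * (J * x i ^ 2) =
          ∑ _j : Fin J, -(ε / 2) * x i ^ 2 by simp; ring, ← Finset.sum_add_distrib]
        exact Finset.sum_congr rfl fun j _ => by ring
      rw [Finset.sum_congr rfl fun i _ => this i, ← Finset.mul_sum, Finset.sum_add_distrib,
        ← Finset.mul_sum]
      simp
      ring
    rw [h1, sub_eq_add_neg, ← h3]
    gcongr with i _ j _
    exact h2 i j
  have h4 : star x ⬝ᵥ S *ᵥ x = ∑ i, ∑ j, x i * (S i j * x j) := by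
    simp [dotProduct, Matrix.mulVec, Finset.mul_sum]
  rw [h4]
  nlinarith [mul_pos (sub_pos.2 hε) hx2]

lemma continuous_covOf_apply (i j : Fin J) : Continuous fun θ : Param J => covOf θ i j := by
  simp only [covOf, Matrix.of_apply]
  fun_prop

lemma mem_interior_theta {s : ℝ} (hs : 0 < s) (b : ℝ) :
    param (s • (1 : Matrix (Fin J) (Fin J) ℝ)) b ∈ interior (Theta J) := by
  rw [mem_interior_iff_mem_nhds]
  -- Dividing by `J + 1` instead of `J` makes `J * ε < s` strict.
  have hε : (0 : ℝ) < s / (J + 1) := by positivity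
  have h : ∀ᶠ η in 𝓝 (param (s • (1 : Matrix (Fin J) (Fin J) ℝ)) b), ∀ i j,
      |covOf η i j - (s • (1 : Matrix (Fin J) (Fin J) ℝ)) i j| < s / (J + 1) := by
    rw [eventually_all]; intro i
    rw [eventually_all]; intro j
    have := (continuous_covOf_apply i j).tendsto (param (s • (1 : Matrix (Fin J) (Fin J) ℝ)) b)
    rw [covOf_param (smul_one_isSymm s)] at this
    exact Metric.tendsto_nhds.1 this _ hε
  filter_upwards [h] with η hη
  refine mem_theta_of_posDef_covOf (posDef_of_abs_sub_lt (covOf_isSymm η) (ε := s / (J + 1))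
    (s := s) ?_ fun i j => (hη i j).le)
  rw [mul_div_assoc', div_lt_iff₀ (by positivity)]
  nlinarith

/-! ### Tangent cones -/

/-- A set that coincides near `t` with the translate of a closed cone has this cone as its
tangent cone. -/
lemma tangentCone_eq_of_isClosed {ι : Type*} [Fintype ι] {T C : Set (EuclideanSpace ℝ ι)}
    {t : EuclideanSpace ℝ ι} (hC : IsClosed C) (hsmul : ∀ r : ℝ, 0 < r → ∀ τ ∈ C, r • τ ∈ C)
    (hT : ∀ θ ∈ T, θ - t ∈ C)
    (hCT : ∀ τ ∈ C, ∃ ε : ℝ, 0 < ε ∧ ∀ r : ℝ, 0 < r → r ≤ ε → t + r • τ ∈ T) :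
    tangentCone T t = C := by
  ext τ
  constructor
  · rintro ⟨α, θ, hα, hθ, -, hlim⟩
    exact hC.mem_of_tendsto hlim (Eventually.of_forall fun n => hsmul _ (hα n) _ (hT _ (hθ n)))
  · intro hτ
    obtain ⟨ε, hε, h⟩ := hCT τ hτ
    have hr : ∀ n : ℕ, 0 < ε / (n + 1 : ℝ) := fun n => by positivity
    have h0 : Tendsto (fun n : ℕ => ε / (n + 1 : ℝ)) atTop (𝓝 0) := by
      have := tendsto_one_div_add_atTop_nhds_zero_nat (𝕜 := ℝ)
      simpa [div_eq_mul_inv] using this.const_mul ε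
    -- Approach `t` along the ray in direction `τ`; rescaling by the inverse step length gives a
    -- constant sequence.
    refine ⟨fun n => (ε / (n + 1 : ℝ))⁻¹, fun n => t + (ε / (n + 1 : ℝ)) • τ,
      fun n => inv_pos.2 (hr n), fun n => h _ (hr n) ?_, ?_, ?_⟩
    · exact div_le_self hε.le (by simp)
    · simpa using (h0.smul_const τ).const_add t
    · simp only [add_sub_cancel_left, smul_smul]
      refine tendsto_const_nhds.congr fun n => ?_
      rw [inv_mul_cancel₀ (hr n).ne', one_smul]

lemma mem_nullSpan_iff {τ : Param J} :
    τ ∈ nullSpan J ↔ ∃ b₀ b₂ : ℝ, τ = param (b₂ • (1 : Matrix (Fin J) (Fin J) ℝ)) b₀ := by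
  rw [nullSpan, Submodule.mem_span_pair]
  refine exists_congr fun b₀ => exists_congr fun b₂ => ?_
  rw [c0, c2, smul_param, smul_param, param_add, eq_comm]
  simp

lemma combination_eq_param (α₀ α₁ α₂ : ℝ) :
    α₀ • c0 J + α₁ • c1 J + α₂ • c2 J = param (reCov J α₁ α₂) α₀ := by
  rw [c0, c1, c2, smul_param, smul_param, smul_param, param_add, param_add, reCov]
  simp

lemma tangentCone_theta0 {s : ℝ} (hs : 0 < s) (b : ℝ) :
    tangentCone (Theta0 J) (param (s • (1 : Matrix (Fin J) (Fin J) ℝ)) b) =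
      (nullSpan J : Set (Param J)) := by
  refine tangentCone_eq_of_isClosed (Submodule.closed_of_finiteDimensional _)
    (fun r _ τ hτ => (nullSpan J).smul_mem r hτ) ?_ ?_
  · rintro _ ⟨s', b', -, rfl⟩
    rw [param_sub, ← sub_smul]
    exact mem_nullSpan_iff.2 ⟨_, _, rfl⟩
  · intro τ hτ
    obtain ⟨b₀, b₂, rfl⟩ := mem_nullSpan_iff.1 hτ
    -- For `r` up to this bound, `r * |b₂| ≤ s - r < s`, so the variance `s + r * b₂` stays
    -- positive.
    refine ⟨s / (|b₂| + 1), by positivity, fun r hr hrε => ?_⟩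
    rw [smul_param, param_add, smul_smul, ← add_smul]
    refine ⟨_, _, ?_, rfl⟩
    rw [le_div_iff₀ (by positivity)] at hrε
    nlinarith [neg_abs_le b₂]

lemma exists_lt_fin (hJ : 2 ≤ J) : ∃ i j : Fin J, i < j :=
  ⟨⟨0, by omega⟩, ⟨1, by omega⟩, by simp⟩

/-- `c₁ - c₂`, the indicator of the off-diagonal coordinates. -/
def offDir (J : ℕ) : Param J := c1 J - c2 J

@[simp] lemma offDir_inl (p : Upper J) :
    offDir J (Sum.inl p) = if p.1.1 = p.1.2 then 0 else 1 := by
  rw [offDir, c1, c2, param_sub, param_inl, Matrix.sub_apply, onesMat_apply, Matrix.one_apply]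
  split_ifs <;> simp

@[simp] lemma offDir_inr (u : Unit) : offDir J (Sum.inr u) = 0 := by
  rw [offDir, c1, c2, param_sub, param_inr, sub_self]

lemma offDir_ne_zero (hJ : 2 ≤ J) : offDir J ≠ 0 := by
  obtain ⟨i, j, hij⟩ := exists_lt_fin hJ
  intro h
  have := congrArg (fun τ : Param J => τ (Sum.inl ⟨(i, j), hij.le⟩)) h
  simp [hij.ne] at this

/-- The supports are disjoint: `offDir J` lives on the off-diagonal coordinates, the null span on
the diagonal ones and the mean. -/
lemma inner_offDir_of_mem_nullSpan {τ : Param J} (hτ : τ ∈ nullSpan J) : ⟪offDir J, τ⟫ = 0 := by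
  obtain ⟨b₀, b₂, rfl⟩ := mem_nullSpan_iff.1 hτ
  rw [PiLp.inner_apply]
  refine Finset.sum_eq_zero ?_
  rintro (p | u) -
  · by_cases h : p.1.1 = p.1.2 <;> simp [h]
  · simp

lemma c2_mem_nullSpan : c2 J ∈ nullSpan J := Submodule.subset_span (by simp)

lemma starProjection_c1 : (nullSpan J).starProjection (c1 J) = c2 J := by
  refine Submodule.eq_starProjection_of_mem_of_inner_eq_zero c2_mem_nullSpan fun w hw => ?_
  exact inner_offDir_of_mem_nullSpan hw

lemma residual_eq : residual J = offDir J := by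
  rw [residual, starProjection_c1, offDir]

lemma linearIndependent_c (hJ : 2 ≤ J) : LinearIndependent ℝ ![c0 J, c1 J, c2 J] := by
  obtain ⟨i, j, hij⟩ := exists_lt_fin hJ
  rw [Fintype.linearIndependent_iff]
  intro g hg
  simp only [Fin.sum_univ_three, Matrix.cons_val_zero, Matrix.cons_val_one, Matrix.cons_val] at hg
  rw [combination_eq_param] at hg
  have h0 := congrArg (fun τ : Param J => τ (Sum.inr ())) hg
  have h1 := congrArg (fun τ : Param J => τ (Sum.inl ⟨(i, j), hij.le⟩)) hg
  have h2 := congrArg (fun τ : Param J => τ (Sum.inl ⟨(i, i), le_rfl⟩)) hg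
  simp only [param_inr, param_inl, reCov_apply, PiLp.zero_apply, hij.ne, if_true, if_false,
    add_zero] at h0 h1 h2
  intro k
  fin_cases k
  · exact h0
  · exact h1
  · simpa [h1] using h2

lemma finrank_nullSpan (hJ : 2 ≤ J) : Module.finrank ℝ (nullSpan J) = 2 := by
  have h := (linearIndependent_c hJ).comp ![0, 2] (by decide)
  have h2 := finrank_span_eq_card h
  have h3 : Set.range (![c0 J, c1 J, c2 J] ∘ ![(0 : Fin 3), 2]) = {c0 J, c2 J} := by
    ext x; simp [Fin.exists_fin_two, eq_comm]
  rw [h3] at h2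
  rw [Fintype.card_fin] at h2
  exact h2

/-- The half-space `{α₀ c₀ + α₁ c₁ + α₂ c₂ : α₁ ≥ 0}`. -/
def altCone (J : ℕ) : Set (Param J) :=
  {τ | ∃ α₀ α₁ α₂ : ℝ, 0 ≤ α₁ ∧ τ = α₀ • c0 J + α₁ • c1 J + α₂ • c2 J}

/-- Any off-diagonal coordinate, available because `2 ≤ J`, equals `α₁`. The cone is thus a
finite-dimensional subspace cut by a closed half-space. -/
lemma isClosed_altCone (hJ : 2 ≤ J) : IsClosed (altCone J) := by
  obtain ⟨i, j, hij⟩ := exists_lt_fin hJ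
  have h : altCone J = (Submodule.span ℝ {c0 J, c1 J, c2 J} : Set (Param J)) ∩
      {τ | 0 ≤ τ (Sum.inl ⟨(i, j), hij.le⟩)} := by
    ext τ
    simp only [altCone, mem_ofPred_eq, mem_inter_iff, SetLike.mem_coe, Submodule.mem_span_triple]
    constructor
    · rintro ⟨α₀, α₁, α₂, h, rfl⟩
      refine ⟨⟨_, _, _, rfl⟩, ?_⟩
      rw [combination_eq_param, param_inl, reCov_apply]
      simpa [hij.ne] using h
    · rintro ⟨⟨α₀, α₁, α₂, rfl⟩, h⟩
      rw [combination_eq_param, param_inl, reCov_apply] at h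
      exact ⟨α₀, α₁, α₂, by simpa [hij.ne] using h, rfl⟩
  rw [h]
  exact (Submodule.closed_of_finiteDimensional _).inter
    (isClosed_le continuous_const (by fun_prop))

lemma tangentCone_theta1 (hJ : 2 ≤ J) {s : ℝ} (hs : 0 < s) (b : ℝ) :
    tangentCone (Theta1 J) (param (s • (1 : Matrix (Fin J) (Fin J) ℝ)) b) = altCone J := by
  refine tangentCone_eq_of_isClosed (isClosed_altCone hJ) ?_ ?_ ?_
  · rintro r hr _ ⟨α₀, α₁, α₂, h, rfl⟩
    exact ⟨r * α₀, r * α₁, r * α₂, by positivity, by simp only [smul_add, smul_smul]⟩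
  · rintro _ ⟨s₁, s₂, b', h₁, -, rfl⟩
    refine ⟨b' - b, s₁, s₂ - s, h₁, ?_⟩
    rw [param_sub, combination_eq_param]
    simp only [reCov, sub_smul, add_sub_assoc]
  · rintro _ ⟨α₀, α₁, α₂, h, rfl⟩
    refine ⟨s / (|α₂| + 1), by positivity, fun r hr hrε => ?_⟩
    refine ⟨r * α₁, s + r * α₂, b + r * α₀, by positivity, ?_, ?_⟩
    · rw [le_div_iff₀ (by positivity)] at hrε
      nlinarith [neg_abs_le α₂]
    · rw [combination_eq_param, smul_param, param_add]
      congr 1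
      simp only [reCov, smul_add, smul_smul, add_smul]
      abel

/-! ### The Gaussian model -/

lemma pi_gaussianReal_eq_withDensity {ι : Type*} [Fintype ι] (m : ℝ) {v : ℝ≥0} (hv : v ≠ 0) :
    Measure.pi (fun _ : ι => gaussianReal m v) =
      (volume : Measure (ι → ℝ)).withDensity
        (fun x => ENNReal.ofReal (∏ i, gaussianPDFReal m v (x i))) := by
  refine Measure.pi_eq fun s hs => ?_
  have hint : Integrable (fun x : ι → ℝ => ∏ i, gaussianPDFReal m v (x i))
      (Measure.pi fun i => (volume : Measure ℝ).restrict (s i)) :=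
    Integrable.fintype_prod fun i => (integrable_gaussianPDFReal m v).restrict
  rw [withDensity_apply _ (MeasurableSet.univ_pi hs), volume_pi, Measure.restrict_pi_pi,
    ← ofReal_integral_eq_lintegral_ofReal hint
      (ae_of_all _ fun x => Finset.prod_nonneg fun i _ => gaussianPDFReal_nonneg _ _ _),
    integral_fintype_prod_eq_prod,
    ENNReal.ofReal_prod_of_nonneg fun i _ => integral_nonneg fun x => gaussianPDFReal_nonneg _ _ _]
  exact Finset.prod_congr rfl fun i _ => (gaussianReal_apply_eq_integral m hv (s i)).symm

lemma prod_gaussianPDFReal (x : Fin J → ℝ) :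
    ∏ i, gaussianPDFReal 0 1 (x i) =
      (Real.sqrt ((2 * Real.pi) ^ J))⁻¹ * Real.exp (-(x ⬝ᵥ x) / 2) := by
  simp only [gaussianPDFReal]
  rw [Finset.prod_mul_distrib, ← Real.exp_sum]
  congr 1
  · have h : √((2 * Real.pi) ^ J) = √(2 * Real.pi) ^ J := by
      rw [Real.sqrt_eq_iff_mul_self_eq (by positivity) (by positivity), ← mul_pow,
        Real.mul_self_sqrt (by positivity)]
    rw [Finset.prod_const, Finset.card_fin, inv_pow, h]
    simp
  · congr 1
    rw [dotProduct, ← Finset.sum_neg_distrib, Finset.sum_div]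
    refine Finset.sum_congr rfl fun i _ => ?_
    simp; ring

lemma stdGaussian_eq_withDensity :
    stdGaussian (Obs J) = volume.withDensity (fun x : Obs J =>
      ENNReal.ofReal ((Real.sqrt ((2 * Real.pi) ^ J))⁻¹ *
        Real.exp (-(x.ofLp ⬝ᵥ x.ofLp) / 2))) := by
  rw [← map_pi_eq_stdGaussian, pi_gaussianReal_eq_withDensity _ one_ne_zero]
  ext s hs
  have hm : MeasurableSet ((WithLp.toLp 2 : (Fin J → ℝ) → Obs J) ⁻¹' s) :=
    (by fun_prop : Measurable (WithLp.toLp 2 : (Fin J → ℝ) → Obs J)) hs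
  rw [Measure.map_apply (by fun_prop) hs, withDensity_apply _ hm, withDensity_apply _ hs,
    ← (PiLp.volume_preserving_toLp (Fin J)).setLIntegral_comp_preimage_emb
      (MeasurableEquiv.toLp 2 (Fin J → ℝ)).measurableEmbedding]
  refine lintegral_congr fun x => ?_
  rw [prod_gaussianPDFReal]

lemma lintegral_affine_image {E : Type*} [NormedAddCommGroup E] [NormedSpace ℝ E]
    [MeasurableSpace E] [BorelSpace E] [FiniteDimensional ℝ E] (μ : Measure E)
    [μ.IsAddHaarMeasure] (A : E →L[ℝ] E) (m : E) (hA : A.det ≠ 0) (f : E → ℝ≥0∞) :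
    ∫⁻ y, f y ∂μ = ∫⁻ x, ENNReal.ofReal |A.det| * f (m + A x) ∂μ := by
  have hinj : Function.Injective (fun x => m + A x) := fun x y h =>
    ((LinearMap.equivOfDetNeZero (A : E →ₗ[ℝ] E) hA).injective (add_left_cancel h))
  have hsurj : Function.Surjective (fun x => m + A x) := fun y => by
    obtain ⟨x, hx⟩ := (LinearMap.equivOfDetNeZero (A : E →ₗ[ℝ] E) hA).surjective (y - m)
    refine ⟨x, ?_⟩
    have hx' : A x = y - m := hx
    simp [hx']
  have h := lintegral_image_eq_lintegral_abs_det_fderiv_mul μ MeasurableSet.univ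
    (f' := fun _ => A) (f := fun x => m + A x)
    (fun x _ => (A.hasFDerivAt.const_add m).hasFDerivWithinAt) hinj.injOn f
  rw [image_univ, hsurj.range_eq] at h
  simpa using h

/-- The measure is the image of the standard Gaussian under `x ↦ m + R x` with `R * R = S`. The
Jacobian `|det R| = √(det S)` cancels against the normalizing constant, and `S⁻¹ = R⁻¹ * R⁻¹`
reduces the quadratic form to `x ⬝ᵥ x`. -/
lemma model_eq_withDensity {η : Param J} (hη : η ∈ Theta J) :
    model η = volume.withDensity (fun x => ENNReal.ofReal (density η x)) := by
  obtain ⟨S, b, hS, rfl⟩ := hη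
  have hc : covOf (param S b) = S := covOf_param (isSymm_of_posDef hS) b
  set m := meanOf (param S b) with hm
  rw [model, hc, ← hm, multivariateGaussian]
  set R := CFC.sqrt S with hR
  have hRR : R * R = S := CFC.sqrt_mul_sqrt_self S hS.posSemidef.nonneg
  have hRsym : Rᵀ = R := by
    have : R.PosSemidef := Matrix.nonneg_iff_posSemidef.1 (CFC.sqrt_nonneg S)
    have h := this.isHermitian
    rwa [Matrix.IsHermitian, Matrix.conjTranspose_eq_transpose_of_trivial] at h
  have hdet : S.det = R.det ^ 2 := by rw [← hRR, Matrix.det_mul, sq]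
  have hR0 : R.det ≠ 0 := fun h => hS.det_pos.ne' (by rw [hdet, h]; simp)
  have hA : (Matrix.toEuclideanCLM (𝕜 := ℝ) R).det = R.det := by
    exact LinearMap.det_toLpLin 2 R
  have hmeas : Measurable (fun x : Obs J => m + Matrix.toEuclideanCLM (𝕜 := ℝ) R x) := by fun_prop
  ext s hs
  rw [Measure.map_apply hmeas hs, stdGaussian_eq_withDensity,
    withDensity_apply _ (hmeas hs), withDensity_apply _ hs, ← lintegral_indicator (hmeas hs),
    ← lintegral_indicator hs, lintegral_affine_image volume (Matrix.toEuclideanCLM (𝕜 := ℝ) R) m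
      (by rwa [hA]) (s.indicator fun a => ENNReal.ofReal (density (param S b) a))]
  refine lintegral_congr fun x => ?_
  by_cases hx : m + Matrix.toEuclideanCLM (𝕜 := ℝ) R x ∈ s
  · rw [indicator_of_mem hx, indicator_of_mem (by exact hx : x ∈ _ ⁻¹' s), hA,
      ← ENNReal.ofReal_mul (abs_nonneg _)]
    congr 1
    rw [density, hc, ← hm, add_sub_cancel_left, ← mul_assoc, Matrix.ofLp_toEuclideanCLM]
    congr 1
    · rw [Real.sqrt_mul (by positivity), hdet, Real.sqrt_sq_eq_abs]
      have := abs_pos.2 hR0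
      field_simp
    · have hinv : S⁻¹ = R⁻¹ * R⁻¹ := by rw [← hRR, Matrix.mul_inv_rev]
      have hu : IsUnit R.det := isUnit_iff_ne_zero.2 hR0
      rw [hinv, Matrix.mulVec_mulVec, Matrix.mul_assoc, Matrix.nonsing_inv_mul _ hu,
        Matrix.mul_one, Matrix.dotProduct_mulVec, ← Matrix.mulVec_transpose,
        Matrix.mulVec_mulVec, Matrix.transpose_nonsing_inv, hRsym, Matrix.nonsing_inv_mul _ hu,
        Matrix.one_mulVec]
  · rw [indicator_of_notMem hx, indicator_of_notMem (by exact hx), mul_zero]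

lemma dotProduct_reCov_mulVec (s₁ s₂ : ℝ) (t : Fin J → ℝ) :
    t ⬝ᵥ reCov J s₁ s₂ *ᵥ t = s₁ * (∑ j, t j) ^ 2 + s₂ * ∑ j, t j ^ 2 := by
  have h : ∀ i, (reCov J s₁ s₂ *ᵥ t) i = s₁ * ∑ j, t j + s₂ * t i := fun i => by
    simp [Matrix.mulVec, dotProduct, reCov_apply, add_mul, Finset.sum_add_distrib, Finset.mul_sum]
  simp only [dotProduct, h, mul_add, Finset.sum_add_distrib, ← Finset.sum_mul]
  congr 1
  · ring
  · rw [Finset.mul_sum]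
    exact Finset.sum_congr rfl fun _ _ => by ring

/-- Characteristic functions agree: by independence the left one factors into the shift, the group
effect evaluated at `∑ j, t j`, and the errors evaluated at each `t j`. Degenerate variances are
allowed. -/
lemma reLaw_eq_model (b : ℝ) (v₁ v₂ : ℝ≥0) :
    reLaw J b v₁ v₂ = model (param (reCov J v₁ v₂) b) := by
  have hmeas : Measurable (fun q : ℝ × (Fin J → ℝ) =>
      (WithLp.toLp 2 (fun j => b + q.1 + q.2 j) : Obs J)) := by fun_prop
  have : IsFiniteMeasure (reLaw J b v₁ v₂) := by
    rw [reLaw]; infer_instance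
  have : IsFiniteMeasure (model (param (reCov J v₁ v₂) b)) := by
    rw [model]; infer_instance
  refine Measure.ext_of_charFun (funext fun t => ?_)
  rw [model, covOf_param (reCov_isSymm _ _), charFun_multivariateGaussian
    (posSemidef_reCov v₁.coe_nonneg v₂.coe_nonneg), dotProduct_reCov_mulVec, meanOf_param, reLaw, charFun_apply,
    integral_map hmeas.aemeasurable (by fun_prop)]
  have h : ∀ q : ℝ × (Fin J → ℝ),
      Complex.exp (⟪(WithLp.toLp 2 (fun j => b + q.1 + q.2 j) : Obs J), t⟫ * Complex.I) =
      (Complex.exp ((b * ∑ j, t j : ℝ) * Complex.I) *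
        Complex.exp ((∑ j, t j : ℝ) * q.1 * Complex.I)) *
        ∏ j, Complex.exp (t j * q.2 j * Complex.I) := fun q => by
    rw [← Complex.exp_sum, ← Complex.exp_add, ← Complex.exp_add]
    congr 1
    rw [← Finset.sum_mul, ← add_mul, ← add_mul]
    congr 1
    rw [PiLp.inner_apply]
    push_cast
    simp only [Finset.mul_sum, Finset.sum_mul, ← Finset.sum_add_distrib]
    refine Finset.sum_congr rfl fun j _ => ?_
    simp
    ring
  simp only [h]
  rw [integral_prod_mul (f := fun x : ℝ => Complex.exp ((b * ∑ j, t j : ℝ) * Complex.I) *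
        Complex.exp ((∑ j, t j : ℝ) * x * Complex.I))
      (g := fun y : Fin J → ℝ => ∏ j, Complex.exp (t j * y j * Complex.I)),
    integral_const_mul, ← charFun_apply_real, charFun_gaussianReal,
    integral_fintype_prod_eq_prod (f := fun (j : Fin J) (y : ℝ) =>
      Complex.exp (t j * y * Complex.I))]
  simp only [← charFun_apply_real, charFun_gaussianReal]
  rw [← Complex.exp_sum, ← Complex.exp_add, ← Complex.exp_add]
  congr 1
  rw [PiLp.inner_apply]
  push_cast
  rw [Finset.sum_sub_distrib]
  simp only [mul_zero, zero_mul, Finset.sum_const_zero,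
    ← Finset.sum_div, ← Finset.mul_sum, RCLike.inner_apply, conj_trivial, Complex.ofReal_mul]
  ring

/-- The centered noise of one group under the null hypothesis. -/
noncomputable abbrev noise (J : ℕ) (v : ℝ≥0) : Measure (Fin J → ℝ) :=
  Measure.pi fun _ => gaussianReal 0 v

lemma reLaw_zero (b : ℝ) (v : ℝ≥0) :
    reLaw J b 0 v = (noise J v).map (fun y => WithLp.toLp 2 (fun j => b + y j)) := by
  rw [reLaw, gaussianReal_zero_var, Measure.dirac_prod, Measure.map_map (by fun_prop) (by fun_prop)]
  congr 1
  ext y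
  simp

/-! ### The score at a scalar covariance matrix -/

/-- `det (1 + r E) = 1 + r * trace E + r² * q(r)` with `q` a polynomial, and `r = t / s`. -/
lemma hasDerivAt_det_smul_one_add {n : Type*} [Fintype n] [DecidableEq n] {s : ℝ} (hs : s ≠ 0)
    (E : Matrix n n ℝ) :
    HasDerivAt (fun t : ℝ => (s • (1 : Matrix n n ℝ) + t • E).det)
      (s ^ Fintype.card n * (E.trace / s)) 0 := by
  have h : ∀ t : ℝ, (s • (1 : Matrix n n ℝ) + t • E).det =
      s ^ Fintype.card n * (1 + (t / s) • E).det := fun t => by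
    rw [← Matrix.det_smul, smul_add, smul_smul, mul_div_cancel₀ _ hs]
  simp only [h]
  refine HasDerivAt.const_mul _ ?_
  have h2 : ∀ t : ℝ, (1 + (t / s) • E).det =
      1 + E.trace * (t / s) + (Matrix.det (1 + (Polynomial.X : Polynomial ℝ) • E.map Polynomial.C)).divX.divX.eval (t / s) * (t / s) ^ 2 :=
    fun t => Matrix.det_one_add_smul _ _
  simp only [h2]
  have hd : HasDerivAt (fun t : ℝ => t / s) (1 / s) 0 := (hasDerivAt_id 0).div_const s
  set q := (Matrix.det (1 + (Polynomial.X : Polynomial ℝ) • E.map Polynomial.C)).divX.divX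
  have hq := (q.hasDerivAt (0 / s)).comp (0 : ℝ) hd
  have := ((hd.const_mul E.trace).const_add 1).add (hq.mul (hd.pow 2))
  exact this.congr_deriv (by simp; ring)

section

attribute [local instance] Matrix.linftyOpNormedRing Matrix.linftyOpNormedAlgebra

/-- Inversion has derivative `E ↦ -u⁻¹ E u⁻¹` at a unit `u`, here `u = s I`. The local operator norm
only serves to make matrices a complete normed algebra; the statement is entrywise. -/
lemma hasDerivAt_inv_smul_one_add {n : Type*} [Fintype n] [DecidableEq n] {s : ℝ} (hs : s ≠ 0)
    (E : Matrix n n ℝ) (i j : n) :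
    HasDerivAt (fun t : ℝ => (s • (1 : Matrix n n ℝ) + t • E)⁻¹ i j) (-(E i j / s ^ 2)) 0 := by
  have hu : IsUnit (s • (1 : Matrix n n ℝ)) := by
    rw [Matrix.isUnit_iff_isUnit_det, Matrix.det_smul]
    simp [hs]
  obtain ⟨u, hu⟩ := hu
  have hinv : (↑u⁻¹ : Matrix n n ℝ) = s⁻¹ • 1 := by
    rw [Units.inv_eq_of_mul_eq_one_right]
    rw [hu]; simp [smul_smul, hs]
  have h1 : HasFDerivAt Ring.inverse _ (↑u : Matrix n n ℝ) := hasFDerivAt_ringInverse (𝕜 := ℝ) u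
  have h2 : HasDerivAt (fun t : ℝ => s • (1 : Matrix n n ℝ) + t • E) E 0 := by
    have := ((hasDerivAt_id (0 : ℝ)).smul_const E).const_add (s • (1 : Matrix n n ℝ))
    rw [one_smul] at this
    exact this
  have h3 := h1.comp_hasDerivAt_of_eq (0 : ℝ) h2 (by simp [hu])
  let L : Matrix n n ℝ →L[ℝ] ℝ := LinearMap.toContinuousLinearMap (Matrix.entryLinearMap ℝ ℝ i j)
  have h4 := L.hasFDerivAt.comp_hasDerivAt (0 : ℝ) h3
  have e : (fun t : ℝ => (s • (1 : Matrix n n ℝ) + t • E)⁻¹ i j) =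
      L ∘ Ring.inverse ∘ (fun t : ℝ => s • (1 : Matrix n n ℝ) + t • E) := by
    ext t
    rw [Matrix.nonsing_inv_eq_ringInverse]
    rfl
  rw [e]
  refine h4.congr_deriv ?_
  have e2 : L ((-((ContinuousLinearMap.mulLeftRight ℝ (Matrix n n ℝ)) ↑u⁻¹) ↑u⁻¹) E) =
      (-((s⁻¹ • (1 : Matrix n n ℝ)) * E * (s⁻¹ • (1 : Matrix n n ℝ)))) i j := by
    rw [← hinv]; rfl
  refine e2.trans ?_
  simp [smul_smul]
  field_simp

end

/-- The directional derivative of the log-density at a scalar covariance matrix. -/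
lemma hasDerivAt_log_density {s : ℝ} (hs : 0 < s) (b : ℝ) (τ : Param J) (x : Obs J) :
    HasDerivAt (fun t : ℝ => Real.log (density
      (param (s • (1 : Matrix (Fin J) (Fin J) ℝ)) b + t • τ) x))
      (-((covOf τ).trace / s) / 2
        + ((fun j => x j - b) ⬝ᵥ covOf τ *ᵥ fun j => x j - b) / (2 * s ^ 2)
        + τ (Sum.inr ()) * (∑ j, (x j - b)) / s) 0 := by
  set E := covOf τ
  set m := τ (Sum.inr ())
  have hcov : ∀ t : ℝ, covOf (param (s • (1 : Matrix (Fin J) (Fin J) ℝ)) b + t • τ) =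
      s • (1 : Matrix (Fin J) (Fin J) ℝ) + t • E := fun t => by
    rw [covOf_add_smul, covOf_param (smul_one_isSymm s)]
  have hmean : ∀ t : ℝ, (x - meanOf (param (s • (1 : Matrix (Fin J) (Fin J) ℝ)) b + t • τ)).ofLp =
      fun j => x j - b - t * m := fun t => by
    ext j
    simp [meanOf, m]; ring
  have hdet := hasDerivAt_det_smul_one_add hs.ne' E
  have hQ : HasDerivAt (fun t : ℝ => ∑ i, (x i - b - t * m) * ∑ j,
      (s • (1 : Matrix (Fin J) (Fin J) ℝ) + t • E)⁻¹ i j * (x j - b - t * m))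
      (∑ i, (-m * ((x i - b) / s) + (x i - b) * ∑ j,
        (-(E i j / s ^ 2) * (x j - b) + (s⁻¹ • (1 : Matrix (Fin J) (Fin J) ℝ)) i j * -m))) 0 := by
    have hlin : ∀ i, HasDerivAt (fun t : ℝ => x i - b - t * m) (-m) 0 := fun i => by
      simpa using ((hasDerivAt_id (0 : ℝ)).mul_const m).const_sub (x i - b)
    have hs1 : (s • (1 : Matrix (Fin J) (Fin J) ℝ))⁻¹ = s⁻¹ • 1 := by
      refine Matrix.inv_eq_right_inv ?_
      simp [smul_smul, hs.ne']
    refine HasDerivAt.fun_sum fun i _ => ?_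
    have := (hlin i).mul (HasDerivAt.fun_sum (u := Finset.univ)
      fun j _ => (hasDerivAt_inv_smul_one_add hs.ne' E i j).mul (hlin j))
    refine this.congr_deriv ?_
    simp [hs1, Matrix.one_apply, ← div_eq_inv_mul]
  -- Splitting the logarithm needs a positive determinant, which is guaranteed only for `t` near
  -- `0`.
  have hlog : ∀ᶠ t : ℝ in 𝓝 0, Real.log (density
      (param (s • (1 : Matrix (Fin J) (Fin J) ℝ)) b + t • τ) x) =
      -(Real.log ((2 * Real.pi) ^ J) + Real.log (s • (1 : Matrix (Fin J) (Fin J) ℝ) + t • E).det) / 2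
      - (∑ i, (x i - b - t * m) * ∑ j,
      (s • (1 : Matrix (Fin J) (Fin J) ℝ) + t • E)⁻¹ i j * (x j - b - t * m)) / 2 := by
    have hpos : ∀ᶠ t : ℝ in 𝓝 0, 0 < (s • (1 : Matrix (Fin J) (Fin J) ℝ) + t • E).det := by
      refine hdet.continuousAt.eventually (lt_mem_nhds ?_)
      simp; positivity
    filter_upwards [hpos] with t ht
    rw [density, hcov, hmean, Real.log_mul (by positivity) (Real.exp_ne_zero _), Real.log_exp,
      Real.log_inv, Real.log_sqrt (by positivity), Real.log_mul (by positivity) ht.ne']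
    simp only [dotProduct, Matrix.mulVec]
    ring
  refine HasDerivAt.congr_of_eventuallyEq ?_ hlog
  have h0 : (s • (1 : Matrix (Fin J) (Fin J) ℝ) + (0 : ℝ) • E).det = s ^ J := by simp
  have := (((hdet.log (by rw [h0]; positivity)).const_add (Real.log ((2 * Real.pi) ^ J))).neg.div_const
    2).sub (hQ.div_const 2)
  refine this.congr_deriv ?_
  rw [h0]
  have h1 : ∀ i, ∑ j, (-(E i j / s ^ 2) * (x j - b) +
      (s⁻¹ • (1 : Matrix (Fin J) (Fin J) ℝ)) i j * -m) =
      -(∑ j, E i j * (x j - b)) / s ^ 2 - m / s := fun i => by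
    rw [Finset.sum_add_distrib]
    simp only [Matrix.smul_apply, Matrix.one_apply, smul_eq_mul, mul_ite, mul_one, mul_zero,
      ite_mul, zero_mul, Finset.sum_ite_eq, Finset.mem_univ, if_true]
    rw [neg_div, Finset.sum_div, ← Finset.sum_neg_distrib, mul_neg, sub_eq_add_neg]
    congr 1
    · exact Finset.sum_congr rfl fun j _ => by ring
    · ring
  have h2 : ∑ i, (-m * ((x i - b) / s) + (x i - b) *
      (-(∑ j, E i j * (x j - b)) / s ^ 2 - m / s)) =
      -(((fun j => x j - b) ⬝ᵥ E *ᵥ fun j => x j - b) / s ^ 2) - 2 * (m * ∑ j, (x j - b) / s) := by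
    simp only [dotProduct, Matrix.mulVec]
    rw [Finset.sum_div, ← Finset.sum_neg_distrib, Finset.mul_sum, Finset.mul_sum,
      ← Finset.sum_sub_distrib]
    exact Finset.sum_congr rfl fun i _ => by ring
  simp only [h1, h2, Fintype.card_fin]
  rw [← Finset.sum_div]
  have := pow_ne_zero J hs.ne'
  field_simp
  ring

/-! ### Moments of the noise -/

/-- Centered Gaussians are symmetric, so flipping the signs of any coordinates preserves the product
law. -/
lemma integral_noise_mul_sign {v : ℝ≥0} (ε : Fin J → ℝ) (hε : ∀ i, ε i = 1 ∨ ε i = -1)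
    {f : (Fin J → ℝ) → ℝ} (hf : Measurable f) :
    ∫ y, f (fun i => ε i * y i) ∂(noise J v) = ∫ y, f y ∂(noise J v) := by
  have h : (noise J v).map (fun y i => ε i * y i) = noise J v := by
    rw [noise, Measure.pi_map_pi (f := fun i (x : ℝ) => ε i * x) (fun _ => by fun_prop)]
    congr 1
    ext1 i
    rw [gaussianReal_map_const_mul]
    rcases hε i with h | h
    · rw [h]; congr 1
      · simp
      · ext; simp
    · rw [h]; congr 1
      · simp
      · ext; simp
  conv_rhs => rw [← h]
  rw [integral_map (Measurable.aemeasurable (by fun_prop)) hf.aestronglyMeasurable]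

/-- The integral of a function that changes sign together with some coordinates vanishes. -/
lemma integral_noise_eq_zero {v : ℝ≥0} (ε : Fin J → ℝ) (hε : ∀ i, ε i = 1 ∨ ε i = -1)
    {f : (Fin J → ℝ) → ℝ} (hf : Measurable f) (hodd : ∀ y, f (fun i => ε i * y i) = -f y) :
    ∫ y, f y ∂(noise J v) = 0 := by
  have h := integral_noise_mul_sign (v := v) ε hε hf
  simp only [hodd, integral_neg] at h
  linarith

lemma memLp_gaussianReal_pow (v : ℝ≥0) (k : ℕ) (p : ℝ≥0) :
    MemLp (fun x : ℝ => x ^ k) p (gaussianReal 0 v) := by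
  rcases Nat.eq_zero_or_pos k with rfl | hk
  · simpa using memLp_const (1 : ℝ)
  · have h := (memLp_id_gaussianReal (μ := 0) (v := v) (p * k)).norm_rpow_div (k : ℝ≥0∞)
    have h2 : MemLp (fun x : ℝ => ‖x‖ ^ k) p (gaussianReal 0 v) := by
      have e : ((p * k : ℝ≥0) : ℝ≥0∞) / (k : ℝ≥0∞) = p := by
        push_cast
        exact ENNReal.mul_div_cancel_right (by exact_mod_cast hk.ne') (by simp)
      rw [e] at h
      simpa using h
    exact h2.mono (by fun_prop) (ae_of_all _ fun x => by simp)

lemma integral_sq_gaussianReal (v : ℝ≥0) : ∫ x, x ^ 2 ∂(gaussianReal 0 v) = v := by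
  have h := variance_of_integral_eq_zero (μ := gaussianReal 0 v) (X := fun x : ℝ => x)
    (by fun_prop) integral_id_gaussianReal
  rw [← h, variance_fun_id_gaussianReal]

/-- The integral of a product of functions of two different coordinates. -/
lemma integral_noise_mul {v : ℝ≥0} {i j : Fin J} (hij : i ≠ j) (f : ℝ → ℝ) :
    ∫ y, f (y i) * f (y j) ∂(noise J v) = (∫ x, f x ∂(gaussianReal 0 v)) ^ 2 := by
  have h : ∀ y : Fin J → ℝ, f (y i) * f (y j) =
      ∏ l, (fun (l : Fin J) (x : ℝ) => if l ∈ ({i, j} : Finset (Fin J)) then f x else 1) l (y l) :=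
    fun y => by
      rw [Finset.prod_ite_mem, Finset.univ_inter, Finset.prod_pair hij]
  rw [integral_congr_ae (ae_of_all _ h), integral_fintype_prod_eq_prod
    (f := fun (l : Fin J) (x : ℝ) => if l ∈ ({i, j} : Finset (Fin J)) then f x else 1)]
  have h2 : ∀ l : Fin J, (∫ x, (if l ∈ ({i, j} : Finset (Fin J)) then f x else 1)
      ∂(gaussianReal 0 v)) =
      if l ∈ ({i, j} : Finset (Fin J)) then ∫ x, f x ∂(gaussianReal 0 v) else 1 := fun l => by
    split_ifs <;> simp
  simp only [h2]
  rw [Finset.prod_ite_mem, Finset.univ_inter, Finset.prod_pair hij, sq]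

lemma integral_noise_eval {v : ℝ≥0} (i : Fin J) {f : ℝ → ℝ} (hf : Measurable f) :
    ∫ y, f (y i) ∂(noise J v) = ∫ x, f x ∂(gaussianReal 0 v) :=
  integral_comp_eval (μ := fun _ : Fin J => gaussianReal 0 v) hf.aestronglyMeasurable

/-- Unless `{k, l}` matches `{i, j}`, one of `i`, `j` occurs exactly once in the product, and
flipping that coordinate changes the sign. -/
lemma integral_noise_fourth {v : ℝ≥0} {i j k l : Fin J} (hij : i ≠ j) :
    ∫ y, (y i * y j) * (y k * y l) ∂(noise J v) =
      if (k = i ∧ l = j) ∨ (k = j ∧ l = i) then (v : ℝ) ^ 2 else 0 := by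
  have hone : ∀ a b : Fin J, (if b = a then (-1 : ℝ) else 1) = 1 ∨
      (if b = a then (-1 : ℝ) else 1) = -1 := fun a b => by split_ifs <;> simp
  split_ifs with h
  · rw [← integral_sq_gaussianReal v, ← integral_noise_mul hij]
    refine integral_congr_ae (ae_of_all _ fun y => ?_)
    rcases h with ⟨rfl, rfl⟩ | ⟨rfl, rfl⟩ <;> ring
  · by_cases h1 : i = k ∨ i = l
    · refine integral_noise_eq_zero (fun b => if b = j then -1 else 1) (hone j) (by fun_prop)
        fun y => ?_
      have h2 : k ≠ j := by grind
      have h3 : l ≠ j := by grind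
      simp [hij, h2, h3]
    · refine integral_noise_eq_zero (fun b => if b = i then -1 else 1) (hone i) (by fun_prop)
        fun y => ?_
      have h2 : k ≠ i := by grind
      have h3 : l ≠ i := by grind
      simp [hij.symm, h2, h3]

lemma memLp_noise_eval (v : ℝ≥0) (i : Fin J) (p : ℝ≥0) :
    MemLp (fun y : Fin J → ℝ => y i) p (noise J v) :=
  (memLp_id_gaussianReal (μ := 0) (v := v) p).comp_measurePreserving
    (measurePreserving_eval (fun _ : Fin J => gaussianReal 0 v) i)

lemma integral_noise_id (v : ℝ≥0) (i : Fin J) : ∫ y, y i ∂(noise J v) = 0 := by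
  rw [integral_noise_eval i (f := fun x => x) measurable_id, integral_id_gaussianReal]

lemma memLp_noise_sum (v : ℝ≥0) (p : ℝ≥0) :
    MemLp (fun y : Fin J → ℝ => ∑ i, y i) p (noise J v) :=
  memLp_finsetSum _ fun i _ => memLp_noise_eval v i p

lemma integral_noise_sum (v : ℝ≥0) : ∫ y, ∑ i, y i ∂(noise J v) = 0 := by
  rw [integral_finsetSum _ fun i _ => (memLp_noise_eval v i 1).integrable (by simp)]
  simp [integral_noise_id]

lemma integral_noise_sum_sq (v : ℝ≥0) : ∫ y, (∑ i, y i) ^ 2 ∂(noise J v) = J * v := by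
  have h := variance_of_integral_eq_zero (μ := noise J v) (X := fun y => ∑ i, y i)
    (by fun_prop) (integral_noise_sum v)
  rw [← h]
  have h2 := variance_sum_pi (μ := fun _ : Fin J => gaussianReal 0 v) (X := fun _ x => x)
    (fun i => memLp_id_gaussianReal 2)
  have e : (∑ i : Fin J, fun ω : Fin J → ℝ => ω i) = fun y => ∑ i, y i := by
    ext y; simp
  rw [e] at h2
  rw [h2]
  simp

/-! ### The score and the Fisher information -/

/-- The score at `(ρ(v I), b)` as a function of the noise. -/
noncomputable def noiseScore (v : ℝ) : Idx J → (Fin J → ℝ) → ℝ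
  | Sum.inl p, y => if p.1.1 = p.1.2 then (y p.1.1 ^ 2 - v) / (2 * v ^ 2)
      else y p.1.1 * y p.1.2 / v ^ 2
  | Sum.inr _, y => (∑ j, y j) / v

lemma covOf_single_inr (u : Unit) : covOf (EuclideanSpace.single (Sum.inr u) 1 : Param J) = 0 := by
  ext i j
  simp [covOf]

/-- An off-diagonal coordinate moves two entries of the symmetric matrix; hence the missing factor
`2` in the corresponding denominator of `noiseScore`. -/
lemma covOf_single_inl (p : Upper J) (i j : Fin J) :
    covOf (EuclideanSpace.single (Sum.inl p) 1 : Param J) i j =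
      if p.1.1 = p.1.2 then (if i = p.1.1 then 1 else 0) * (if j = p.1.1 then 1 else 0)
      else (if i = p.1.1 then 1 else 0) * (if j = p.1.2 then 1 else 0) +
        (if i = p.1.2 then 1 else 0) * (if j = p.1.1 then 1 else 0) := by
  obtain ⟨⟨a, b⟩, hab⟩ := p
  have hab' : a ≤ b := hab
  simp only [covOf, Matrix.of_apply, PiLp.single_apply, Sum.inl.injEq, Subtype.mk.injEq,
    Prod.mk.injEq]
  rcases le_total i j with h | h
  · simp only [min_eq_left h, max_eq_right h]
    grind
  · simp only [min_eq_right h, max_eq_left h]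
    grind

lemma score_eq {v : ℝ} (hv : 0 < v) (b : ℝ) (a : Idx J) (y : Fin J → ℝ) :
    score (param (v • (1 : Matrix (Fin J) (Fin J) ℝ)) b) a (WithLp.toLp 2 fun j => b + y j) =
      noiseScore v a y := by
  rw [score, lineDeriv, (hasDerivAt_log_density hv b _ _).deriv]
  simp only [add_sub_cancel_left]
  rcases a with p | u
  · have h1 : (covOf (EuclideanSpace.single (Sum.inl p) 1 : Param J)).trace =
        if p.1.1 = p.1.2 then 1 else 0 := by
      rw [Matrix.trace]
      simp only [Matrix.diag_apply, covOf_single_inl]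
      split_ifs with h
      · simp
      · refine Finset.sum_eq_zero fun i _ => ?_
        split_ifs with h1 h2 h2 <;> first | exact absurd (h1.symm.trans h2) h | simp
    have h2 : y ⬝ᵥ covOf (EuclideanSpace.single (Sum.inl p) 1 : Param J) *ᵥ y =
        if p.1.1 = p.1.2 then y p.1.1 ^ 2 else 2 * (y p.1.1 * y p.1.2) := by
      simp only [dotProduct, Matrix.mulVec, covOf_single_inl]
      split_ifs with h
      · simp [sq]
      · simp [add_mul, mul_add, Finset.sum_add_distrib]
        ring
    rw [h1, h2, noiseScore]
    have : v ≠ 0 := hv.ne'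
    split_ifs <;> simp <;> field_simp
    ring
  · rw [covOf_single_inr]
    simp [noiseScore]

lemma measurable_noiseScore (v : ℝ) (a : Idx J) : Measurable (noiseScore v a) := by
  rcases a with p | u
  · change Measurable fun y : Fin J → ℝ => if p.1.1 = p.1.2 then _ else _
    split_ifs <;> fun_prop
  · change Measurable fun y : Fin J → ℝ => (∑ j, y j) / v
    fun_prop

/-- The diagonal entries of the Fisher information at a scalar covariance matrix. -/
noncomputable def fisherDiag (J : ℕ) (v : ℝ≥0) : Idx J → ℝ
  | Sum.inl p => if p.1.1 = p.1.2 then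
      (∫ x, (x ^ 2 - (v : ℝ)) ^ 2 ∂(gaussianReal 0 v)) / (2 * (v : ℝ) ^ 2) ^ 2 else ((v : ℝ) ^ 2)⁻¹
  | Sum.inr _ => J / v

lemma integral_noiseScore_self {v : ℝ≥0} (hv : 0 < v) (a : Idx J) :
    ∫ y, noiseScore v a y * noiseScore v a y ∂(noise J v) = fisherDiag J v a := by
  have hv' : (v : ℝ) ≠ 0 := by exact_mod_cast hv.ne'
  rcases a with p | u
  · by_cases h : p.1.1 = p.1.2
    · simp only [noiseScore, fisherDiag, h, if_true]
      rw [integral_noise_eval p.1.2 (f := fun x => (x ^ 2 - (v : ℝ)) / (2 * (v : ℝ) ^ 2) *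
        ((x ^ 2 - (v : ℝ)) / (2 * (v : ℝ) ^ 2))) (by fun_prop), ← integral_div]
      exact integral_congr_ae (ae_of_all _ fun x => by ring)
    · simp only [noiseScore, fisherDiag, h, if_false]
      have h4 := integral_noise_fourth (v := v) (k := p.1.1) (l := p.1.2) h
      simp only [and_self, true_or, if_true] at h4
      have : ∀ y : Fin J → ℝ, y p.1.1 * y p.1.2 / (v : ℝ) ^ 2 * (y p.1.1 * y p.1.2 / (v : ℝ) ^ 2) =
          (y p.1.1 * y p.1.2) * (y p.1.1 * y p.1.2) / (v : ℝ) ^ 4 := fun y => by ring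
      simp only [this]
      rw [integral_div, h4]
      field_simp
  · simp only [noiseScore, fisherDiag]
    have : ∀ y : Fin J → ℝ, (∑ j, y j) / (v : ℝ) * ((∑ j, y j) / v) = (∑ j, y j) ^ 2 / (v : ℝ) ^ 2 :=
      fun y => by ring
    simp only [this]
    rw [integral_div, integral_noise_sum_sq]
    field_simp

/-- Under `y ↦ -y` the covariance scores are even and the mean score is odd. -/
lemma integral_noiseScore_inl_inr (v : ℝ≥0) (p : Upper J) (u : Unit) :
    ∫ y, noiseScore v (Sum.inl p) y * noiseScore v (Sum.inr u) y ∂(noise J v) = 0 := by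
  refine integral_noise_eq_zero (fun _ => -1) (fun _ => Or.inr rfl)
    ((measurable_noiseScore _ _).mul (measurable_noiseScore _ _)) fun y => ?_
  simp only [noiseScore, neg_one_mul, Finset.sum_neg_distrib]
  split_ifs <;> ring

/-- Flipping one of the two coordinates of `p` negates their product and leaves every square
unchanged. -/
lemma integral_noiseScore_off_diag (v : ℝ≥0) {p q : Upper J} (hp : p.1.1 ≠ p.1.2)
    (hq : q.1.1 = q.1.2) :
    ∫ y, noiseScore v (Sum.inl p) y * noiseScore v (Sum.inl q) y ∂(noise J v) = 0 := by
  refine integral_noise_eq_zero (fun i => if i = p.1.1 then -1 else 1)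
    (fun i => by split_ifs <;> simp)
    ((measurable_noiseScore _ _).mul (measurable_noiseScore _ _)) fun y => ?_
  simp only [noiseScore, hp, hp.symm, hq, if_true, if_false]
  split_ifs <;> ring

lemma integral_noiseScore_of_ne {v : ℝ≥0} {a b : Idx J} (hab : a ≠ b) :
    ∫ y, noiseScore v a y * noiseScore v b y ∂(noise J v) = 0 := by
  rcases a with p | u <;> rcases b with q | w
  · have hpq : p ≠ q := fun h => hab (by rw [h])
    by_cases hp : p.1.1 = p.1.2 <;> by_cases hq : q.1.1 = q.1.2
    · have hne : p.1.1 ≠ q.1.1 := fun h =>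
        hpq (Subtype.ext (Prod.ext h (by rw [← hp, ← hq, h])))
      simp only [noiseScore, hp, hq, if_true]
      rw [hp, hq] at hne
      rw [integral_noise_mul hne (fun x => (x ^ 2 - (v : ℝ)) / (2 * (v : ℝ) ^ 2)), integral_div,
        integral_sub ((memLp_gaussianReal_pow v 2 1).integrable (by simp)) (integrable_const _),
        integral_sq_gaussianReal]
      simp
    · simp only [mul_comm (noiseScore (v : ℝ) (Sum.inl p) _)]
      exact integral_noiseScore_off_diag v hq hp
    · exact integral_noiseScore_off_diag v hp hq
    · simp only [noiseScore, hp, hq, if_false]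
      have : ∀ y : Fin J → ℝ, y p.1.1 * y p.1.2 / (v : ℝ) ^ 2 * (y q.1.1 * y q.1.2 / (v : ℝ) ^ 2) =
          (y p.1.1 * y p.1.2) * (y q.1.1 * y q.1.2) / (v : ℝ) ^ 4 := fun y => by ring
      simp only [this]
      rw [integral_div, integral_noise_fourth hp, if_neg, zero_div]
      rintro (⟨h1, h2⟩ | ⟨h1, h2⟩)
      · exact hpq (Subtype.ext (Prod.ext h1.symm h2.symm))
      -- If `q` were `p` with its entries swapped, the two ordering constraints would force `p` onto
      -- the diagonal.
      · have h3 := p.2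
        have h4 := q.2
        rw [h1, h2] at h4
        exact hp (le_antisymm h3 h4)
  · exact integral_noiseScore_inl_inr v p w
  · simp only [mul_comm (noiseScore (v : ℝ) (Sum.inr u) _)]
    exact integral_noiseScore_inl_inr v q u
  · exact absurd rfl hab

lemma fisher_eq {v : ℝ≥0} (hv : 0 < v) (b : ℝ) :
    fisher (param ((v : ℝ) • (1 : Matrix (Fin J) (Fin J) ℝ)) b) =
      Matrix.diagonal (fisherDiag J v) := by
  have hmod : model (param ((v : ℝ) • (1 : Matrix (Fin J) (Fin J) ℝ)) b) =
      (noise J v).map (fun y => WithLp.toLp 2 (fun j => b + y j)) := by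
    rw [← reLaw_zero, reLaw_eq_model, NNReal.coe_zero, reCov_zero]
  ext a c
  have e : MeasurableEmbedding fun y : Fin J → ℝ => (WithLp.toLp 2 (fun j => b + y j) : Obs J) :=
    (MeasurableEquiv.toLp 2 (Fin J → ℝ)).measurableEmbedding.comp
      (MeasurableEquiv.addLeft (fun _ : Fin J => b)).measurableEmbedding
  rw [fisher, Matrix.of_apply, hmod, e.integral_map]
  simp only [score_eq (NNReal.coe_pos.2 hv)]
  by_cases hac : a = c
  · rw [hac, Matrix.diagonal_apply_eq, integral_noiseScore_self hv]
  · rw [Matrix.diagonal_apply_ne _ hac, integral_noiseScore_of_ne hac]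

/-- The fourth-moment integral is never evaluated; it is positive because its integrand vanishes
only at `±√v`, a null set. -/
lemma fisherDiag_pos (hJ : 0 < J) {v : ℝ≥0} (hv : 0 < v) (a : Idx J) : 0 < fisherDiag J v a := by
  have hv' : 0 < (v : ℝ) := NNReal.coe_pos.2 hv
  rcases a with p | u
  · rw [fisherDiag]
    split_ifs
    · refine div_pos ?_ (by positivity)
      have hint : Integrable (fun x : ℝ => (x ^ 2 - (v : ℝ)) ^ 2) (gaussianReal 0 v) :=
        (((memLp_gaussianReal_pow v 2 2).sub (memLp_const (v : ℝ))).integrable_sq)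
      rw [integral_pos_iff_support_of_nonneg (fun x => sq_nonneg _) hint, pos_iff_ne_zero]
      intro h0
      have : NullSingletonClass (gaussianReal 0 v) := nullSingletonClass_gaussianReal hv.ne'
      have hfin : (Function.support fun x : ℝ => (x ^ 2 - (v : ℝ)) ^ 2)ᶜ.Finite := by
        refine (Set.toFinite {√(v : ℝ), -√(v : ℝ)}).subset fun x hx => ?_
        have hx' : x ^ 2 = √(v : ℝ) ^ 2 := by
          rw [Real.sq_sqrt hv'.le]
          simpa [sub_eq_zero] using hx
        exact sq_eq_sq_iff_eq_or_eq_neg.1 hx'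
      have h1 := measure_union_le (μ := gaussianReal 0 v)
        (Function.support fun x : ℝ => (x ^ 2 - (v : ℝ)) ^ 2)
        (Function.support fun x : ℝ => (x ^ 2 - (v : ℝ)) ^ 2)ᶜ
      rw [union_compl_self, measure_univ, h0, hfin.measure_zero] at h1
      simp at h1
    · positivity
  · rw [fisherDiag]
    have : (0 : ℝ) < J := Nat.cast_pos.2 hJ
    positivity

lemma posDef_fisher (hJ : 0 < J) {v : ℝ≥0} (hv : 0 < v) (b : ℝ) :
    (fisher (param ((v : ℝ) • (1 : Matrix (Fin J) (Fin J) ℝ)) b)).PosDef := by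
  rw [fisher_eq hv]
  exact Matrix.PosDef.diagonal fun a => fisherDiag_pos hJ hv a

lemma sqrt_fisher (hJ : 0 < J) {v : ℝ≥0} (hv : 0 < v) (b : ℝ) :
    CFC.sqrt (fisher (param ((v : ℝ) • (1 : Matrix (Fin J) (Fin J) ℝ)) b)) =
      Matrix.diagonal (fun a => √(fisherDiag J v a)) := by
  rw [fisher_eq hv]
  refine CFC.sqrt_unique ?_ (Matrix.PosSemidef.diagonal fun a => Real.sqrt_nonneg _).nonneg
  rw [Matrix.diagonal_mul_diagonal]
  congr 1
  ext a
  exact Real.mul_self_sqrt (fisherDiag_pos hJ hv a).le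

/-! ### The limiting statistic -/

lemma posSq_smul {c : ℝ} (hc : 0 < c) (w : ℝ) : posSq (c * w) = c ^ 2 * posSq w := by
  simp only [posSq, mul_nonneg_iff_of_pos_left hc]
  split_ifs <;> ring

lemma posSq_eq_max_sq (w : ℝ) : posSq w = max w 0 ^ 2 := by
  rw [posSq]
  split_ifs with h
  · rw [max_eq_left h]
  · rw [max_eq_right (not_le.1 h).le]; ring

lemma continuous_posSq : Continuous posSq := by
  rw [funext posSq_eq_max_sq]
  fun_prop

/-! ### Squared distances to a subspace and to a half-space -/

section Projection

variable {E : Type*} [NormedAddCommGroup E] [InnerProductSpace ℝ E] (K : Submodule ℝ E)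
  [K.HasOrthogonalProjection]

lemma norm_sub_sq_of_mem {z n : E} (hn : n ∈ K) :
    ‖z - n‖ ^ 2 = ‖K.starProjection z - n‖ ^ 2 + ‖z - K.starProjection z‖ ^ 2 := by
  have h0 : ⟪K.starProjection z - n, z - K.starProjection z⟫ = 0 :=
    K.sub_starProjection_mem_orthogonal z _
      (K.sub_mem (K.starProjection_apply_mem z) hn)
  have := norm_add_sq_real (K.starProjection z - n) (z - K.starProjection z)
  rw [h0] at this
  rw [show z - n = (K.starProjection z - n) + (z - K.starProjection z) by abel, this]
  ring

lemma isLeast_dist_sq (z : E) :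
    IsLeast ((fun n => ‖z - n‖ ^ 2) '' (K : Set E)) (‖z - K.starProjection z‖ ^ 2) := by
  refine ⟨⟨_, K.starProjection_apply_mem z, rfl⟩, ?_⟩
  rintro _ ⟨n, hn, rfl⟩
  dsimp only
  rw [norm_sub_sq_of_mem K hn]
  nlinarith [sq_nonneg ‖K.starProjection z - n‖]

/-- The squared distance to the half-space `{n + γ v : n ∈ K, γ ≥ 0}`, `v` a unit vector orthogonal
to `K`. -/
lemma isLeast_dist_sq_halfspace {v : E} (hv : ‖v‖ = 1) (hvK : ∀ n ∈ K, ⟪v, n⟫ = 0) (z : E) :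
    IsLeast ((fun x => ‖z - x‖ ^ 2) '' {x | ∃ n ∈ K, ∃ γ : ℝ, 0 ≤ γ ∧ x = n + γ • v})
      (‖z - K.starProjection z‖ ^ 2 - posSq ⟪v, z⟫) := by
  -- Orthogonality of `v` to `K` decouples the minimization over `n` from the one over `γ`.
  have key : ∀ n ∈ K, ∀ γ : ℝ, ‖z - (n + γ • v)‖ ^ 2 =
      ‖K.starProjection z - n‖ ^ 2 + ‖z - K.starProjection z‖ ^ 2 - 2 * γ * ⟪v, z⟫ + γ ^ 2 := by
    intro n hn γ
    have h1 : ⟪z - n, γ • v⟫ = γ * ⟪v, z⟫ := by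
      rw [real_inner_smul_right, real_inner_comm, inner_sub_right, hvK n hn, sub_zero]
    rw [← sub_sub, norm_sub_sq_real, h1, norm_sub_sq_of_mem K hn, norm_smul, hv, mul_one,
      Real.norm_eq_abs, sq_abs]
    ring
  constructor
  -- The positive part of `⟪v, z⟫` minimizes `γ² - 2 γ ⟪v, z⟫` over `γ ≥ 0`.
  · refine ⟨_, ⟨_, K.starProjection_apply_mem z, max ⟪v, z⟫ 0, le_max_right _ _, rfl⟩, ?_⟩
    dsimp only
    rw [key _ (K.starProjection_apply_mem z), sub_self, norm_zero, posSq]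
    split_ifs with h
    · rw [max_eq_left h]; ring
    · rw [max_eq_right (not_le.1 h).le]; ring
  · rintro _ ⟨_, ⟨n, hn, γ, hγ, rfl⟩, rfl⟩
    dsimp only
    rw [key n hn, posSq]
    split_ifs with h
    · nlinarith [sq_nonneg ‖K.starProjection z - n‖, sq_nonneg (γ - ⟪v, z⟫)]
    · nlinarith [sq_nonneg ‖K.starProjection z - n‖, mul_nonneg hγ (neg_nonneg.2 (not_le.1 h).le)]

end Projection

lemma norm_dirV (hJ : 2 ≤ J) : ‖dirV J‖ = 1 := by
  have h : residual J ≠ 0 := by rw [residual_eq]; exact offDir_ne_zero hJ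
  rw [dirV, norm_smul, norm_inv, norm_norm, inv_mul_cancel₀ (norm_ne_zero_iff.2 h)]

lemma offDir_eq_smul_dirV (hJ : 2 ≤ J) : offDir J = ‖offDir J‖ • dirV J := by
  rw [dirV, residual_eq, smul_smul, mul_inv_cancel₀ (norm_ne_zero_iff.2 (offDir_ne_zero hJ)),
    one_smul]

/-! ### Images of the tangent cones under the square root of the Fisher information -/

section Transform

variable {v : ℝ≥0}

/-- The common value of the Fisher information at the coordinates of the variances. -/
noncomputable def varInfo (v : ℝ≥0) : ℝ :=
  (∫ x, (x ^ 2 - (v : ℝ)) ^ 2 ∂(gaussianReal 0 v)) / (2 * (v : ℝ) ^ 2) ^ 2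

/-- The image of `α₀ c₀ + α₁ c₁ + α₂ c₂` under the square root of the Fisher information. -/
lemma sqrt_fisher_apply (hJ : 0 < J) (hv : 0 < v) (b α₀ α₁ α₂ : ℝ) :
    Matrix.toEuclideanCLM (𝕜 := ℝ)
      (CFC.sqrt (fisher (param ((v : ℝ) • (1 : Matrix (Fin J) (Fin J) ℝ)) b)))
      (α₀ • c0 J + α₁ • c1 J + α₂ • c2 J) =
    param ((√(varInfo v) * (α₁ + α₂)) • (1 : Matrix (Fin J) (Fin J) ℝ)) (√(J / v) * α₀) +
      (α₁ / v) • offDir J := by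
  have hv' : (0 : ℝ) < v := NNReal.coe_pos.2 hv
  rw [sqrt_fisher hJ hv, combination_eq_param]
  ext a
  rw [Matrix.ofLp_toEuclideanCLM, Matrix.mulVec_diagonal, PiLp.add_apply, PiLp.smul_apply]
  rcases a with p | u
  · rw [param_inl, param_inl, reCov_apply, offDir_inl, fisherDiag]
    by_cases h : p.1.1 = p.1.2
    · simp [h, varInfo]
    · simp [h, div_eq_inv_mul]
  · rw [param_inr, param_inr, offDir_inr, fisherDiag]
    simp

lemma varInfo_pos (hv : 0 < v) : 0 < varInfo v := by
  have := fisherDiag_pos (J := 1) one_pos hv (Sum.inl ⟨(0, 0), le_rfl⟩)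
  simpa [fisherDiag, varInfo] using this

lemma image_nullSpan (hJ : 0 < J) (hv : 0 < v) (b : ℝ) :
    Matrix.toEuclideanCLM (𝕜 := ℝ)
      (CFC.sqrt (fisher (param ((v : ℝ) • (1 : Matrix (Fin J) (Fin J) ℝ)) b))) ''
      (nullSpan J : Set (Param J)) = (nullSpan J : Set (Param J)) := by
  have hv' : (0 : ℝ) < v := NNReal.coe_pos.2 hv
  have hJ' : (0 : ℝ) < J := Nat.cast_pos.2 hJ
  have hk := Real.sqrt_pos.2 (varInfo_pos hv)
  have hk2 : 0 < √((J : ℝ) / v) := by positivity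
  ext x
  constructor
  · rintro ⟨τ, hτ, rfl⟩
    obtain ⟨b₀, b₂, rfl⟩ := mem_nullSpan_iff.1 hτ
    rw [← reCov_zero b₂, ← combination_eq_param b₀ 0 b₂, sqrt_fisher_apply hJ hv, zero_div,
      zero_smul, add_zero]
    exact mem_nullSpan_iff.2 ⟨_, _, rfl⟩
  · intro hx
    obtain ⟨b₀, b₂, rfl⟩ := mem_nullSpan_iff.1 hx
    refine ⟨(b₀ / √((J : ℝ) / v)) • c0 J + (0 : ℝ) • c1 J + (b₂ / √(varInfo v)) • c2 J, ?_, ?_⟩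
    · rw [combination_eq_param, reCov_zero]
      exact mem_nullSpan_iff.2 ⟨_, _, rfl⟩
    · rw [sqrt_fisher_apply hJ hv, zero_div, zero_smul, add_zero, zero_add,
        mul_div_cancel₀ _ hk.ne', mul_div_cancel₀ _ hk2.ne']

/-- Modulo `nullSpan J`, which is preserved, `c₁` is `offDir J`, and this is an eigenvector with
eigenvalue `1 / v`. For this reason the direction `dirV J`, defined without the Fisher information,
is the right one. -/
lemma image_altCone (hJ : 2 ≤ J) (hv : 0 < v) (b : ℝ) :
    Matrix.toEuclideanCLM (𝕜 := ℝ)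
      (CFC.sqrt (fisher (param ((v : ℝ) • (1 : Matrix (Fin J) (Fin J) ℝ)) b))) '' altCone J =
      {x | ∃ n ∈ nullSpan J, ∃ γ : ℝ, 0 ≤ γ ∧ x = n + γ • dirV J} := by
  have hv' : (0 : ℝ) < v := NNReal.coe_pos.2 hv
  have hJ0 : 0 < J := by omega
  have hJ' : (0 : ℝ) < J := Nat.cast_pos.2 hJ0
  have hk := Real.sqrt_pos.2 (varInfo_pos hv)
  have hk2 : 0 < √((J : ℝ) / v) := by positivity
  have hn : 0 < ‖offDir J‖ := norm_pos_iff.2 (offDir_ne_zero hJ)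
  ext x
  constructor
  · rintro ⟨_, ⟨α₀, α₁, α₂, h, rfl⟩, rfl⟩
    rw [sqrt_fisher_apply hJ0 hv]
    refine ⟨param ((√(varInfo v) * (α₁ + α₂)) • (1 : Matrix (Fin J) (Fin J) ℝ)) (√(J / v) * α₀),
      mem_nullSpan_iff.2 ⟨_, _, rfl⟩, α₁ / v * ‖offDir J‖, by positivity, ?_⟩
    rw [mul_smul (α₁ / (v : ℝ)), ← offDir_eq_smul_dirV hJ]
  · rintro ⟨n, hx, γ, hγ, rfl⟩
    obtain ⟨b₀, b₂, rfl⟩ := mem_nullSpan_iff.1 hx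
    refine ⟨_, ⟨b₀ / √((J : ℝ) / v), v * (γ / ‖offDir J‖),
      b₂ / √(varInfo v) - v * (γ / ‖offDir J‖), by positivity, rfl⟩, ?_⟩
    rw [sqrt_fisher_apply hJ0 hv, add_sub_cancel, mul_div_cancel₀ _ hk.ne',
      mul_div_cancel₀ _ hk2.ne', mul_div_cancel_left₀ _ hv'.ne', offDir_eq_smul_dirV hJ, smul_smul,
      norm_smul, norm_dirV hJ, norm_norm, mul_one, div_mul_cancel₀ _ hn.ne']

lemma isLeast_sqDists_theta0 (hJ : 0 < J) (hv : 0 < v) (b : ℝ) (z : Param J) :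
    IsLeast (sqDists (param ((v : ℝ) • (1 : Matrix (Fin J) (Fin J) ℝ)) b)
      (tangentCone (Theta0 J) (param ((v : ℝ) • (1 : Matrix (Fin J) (Fin J) ℝ)) b)) z)
      (‖z - (nullSpan J).starProjection z‖ ^ 2) := by
  have h := isLeast_dist_sq (nullSpan J) z
  rw [← image_nullSpan hJ hv b, image_image] at h
  rw [sqDists, tangentCone_theta0 (NNReal.coe_pos.2 hv)]
  exact h

lemma isLeast_sqDists_theta1 (hJ : 2 ≤ J) (hv : 0 < v) (b : ℝ) (z : Param J) :
    IsLeast (sqDists (param ((v : ℝ) • (1 : Matrix (Fin J) (Fin J) ℝ)) b)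
      (tangentCone (Theta1 J) (param ((v : ℝ) • (1 : Matrix (Fin J) (Fin J) ℝ)) b)) z)
      (‖z - (nullSpan J).starProjection z‖ ^ 2 - posSq ⟪dirV J, z⟫) := by
  have h := isLeast_dist_sq_halfspace (nullSpan J) (norm_dirV hJ) (fun n hn => by
    rw [dirV, residual_eq, real_inner_smul_left, inner_offDir_of_mem_nullSpan hn, mul_zero]) z
  rw [← image_altCone hJ hv b, image_image] at h
  rw [sqDists, tangentCone_theta1 hJ (NNReal.coe_pos.2 hv)]
  exact h

lemma limitStat_eq (hJ : 2 ≤ J) (hv : 0 < v) (b : ℝ) (z : Param J) :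
    limitStat (param ((v : ℝ) • (1 : Matrix (Fin J) (Fin J) ℝ)) b) z = posSq ⟪dirV J, z⟫ := by
  rw [limitStat, (isLeast_sqDists_theta0 (by omega) hv b z).csInf_eq,
    (isLeast_sqDists_theta1 hJ hv b z).csInf_eq, sub_sub_cancel]

end Transform

lemma map_inner_stdGaussian {E : Type*} [NormedAddCommGroup E] [InnerProductSpace ℝ E]
    [FiniteDimensional ℝ E] [MeasurableSpace E] [BorelSpace E] {v : E} (hv : ‖v‖ = 1) :
    (stdGaussian E).map (fun z => ⟪v, z⟫) = gaussianReal 0 1 := by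
  have h := IsGaussian.map_eq_gaussianReal (μ := stdGaussian E) (innerSL ℝ v)
  rw [integral_strongDual_stdGaussian, variance_dual_stdGaussian, innerSL_apply_norm, hv] at h
  simpa using h

/-! ### The likelihood of the random effects model -/

/-- The mean of one group. -/
noncomputable def groupMean (x : Obs J) : ℝ := (∑ j, x j) / J

/-- The sum of squares within one group. -/
noncomputable def groupSS (x : Obs J) : ℝ := ∑ j, (x j - groupMean x) ^ 2

/-- Rank-one determinant formula. The quotient avoids the exponent `J - 1` in natural numbers. -/
lemma det_reCov {s₁ s₂ : ℝ} (h₂ : s₂ ≠ 0) :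
    (reCov J s₁ s₂).det = s₂ ^ J * ((s₂ + J * s₁) / s₂) := by
  have h : reCov J s₁ s₂ = s₂ • (1 + Matrix.replicateCol Unit (fun _ : Fin J => s₁ / s₂) *
      Matrix.replicateRow Unit (fun _ : Fin J => (1 : ℝ))) := by
    ext i j
    simp only [reCov_apply, Matrix.smul_apply, Matrix.add_apply, Matrix.mul_apply,
      Matrix.replicateCol_apply, Matrix.replicateRow_apply, Finset.univ_unique,
      Finset.sum_singleton, Matrix.one_apply, smul_eq_mul]
    split_ifs <;> field_simp <;> ring
  rw [h, Matrix.det_smul, Matrix.det_one_add_replicateCol_mul_replicateRow, Fintype.card_fin]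
  congr 1
  simp [dotProduct]
  field_simp

/-- Deviations from the mean and constant vectors are eigenvectors, with eigenvalues `s₂` and `s₂ +
J * s₁`. -/
lemma inv_reCov_mulVec (hJ : 0 < J) {s₁ s₂ : ℝ} (h₁ : 0 ≤ s₁) (h₂ : 0 < s₂) (y : Fin J → ℝ) :
    (reCov J s₁ s₂)⁻¹ *ᵥ y = fun j =>
      (y j - (∑ i, y i) / J) / s₂ + (∑ i, y i) / J / (s₂ + J * s₁) := by
  have hJ' : (0 : ℝ) < J := Nat.cast_pos.2 hJ
  have ha : 0 < s₂ + J * s₁ := by positivity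
  set m := (∑ i, y i) / J with hm
  have hsum : ∑ j, ((y j - m) / s₂ + m / (s₂ + J * s₁)) = J * m / (s₂ + J * s₁) := by
    rw [Finset.sum_add_distrib, ← Finset.sum_div, Finset.sum_sub_distrib]
    have : ∑ i, y i = J * m := by rw [hm]; field_simp
    rw [this]
    simp
    ring
  have h : reCov J s₁ s₂ *ᵥ (fun j => (y j - m) / s₂ + m / (s₂ + J * s₁)) = y := by
    ext i
    have : (reCov J s₁ s₂ *ᵥ (fun j => (y j - m) / s₂ + m / (s₂ + J * s₁))) i =
        s₁ * (∑ j, ((y j - m) / s₂ + m / (s₂ + J * s₁)))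
          + s₂ * ((y i - m) / s₂ + m / (s₂ + J * s₁)) := by
      rw [Finset.mul_sum]
      simp [Matrix.mulVec, dotProduct, reCov_apply, add_mul, Finset.sum_add_distrib]
    rw [this, hsum]
    field_simp
    ring
  have hu : IsUnit (reCov J s₁ s₂).det := isUnit_iff_ne_zero.2 (posDef_reCov h₁ h₂).det_pos.ne'
  conv_lhs => rw [← h]
  rw [Matrix.mulVec_mulVec, Matrix.nonsing_inv_mul _ hu, Matrix.one_mulVec]

lemma log_density_reCov (hJ : 0 < J) {s₁ s₂ : ℝ} (h₁ : 0 ≤ s₁) (h₂ : 0 < s₂) (b : ℝ) (x : Obs J) :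
    Real.log (density (param (reCov J s₁ s₂) b) x) =
      -(J * Real.log (2 * Real.pi) + (J - 1) * Real.log s₂ + Real.log (s₂ + J * s₁)
        + groupSS x / s₂ + J * (groupMean x - b) ^ 2 / (s₂ + J * s₁)) / 2 := by
  have hJ' : (0 : ℝ) < J := Nat.cast_pos.2 hJ
  have ha : 0 < s₂ + J * s₁ := by positivity
  have hdet := (posDef_reCov (J := J) h₁ h₂).det_pos
  have hmean : (x - meanOf (param (reCov J s₁ s₂) b)).ofLp = fun j => x j - b := by
    ext j; simp [meanOf]
  have hsum : ∑ i, (x i - b) = J * (groupMean x - b) := by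
    rw [Finset.sum_sub_distrib, groupMean]
    simp
    field_simp
  have hss : ∑ j, (x j - b) ^ 2 = groupSS x + J * (groupMean x - b) ^ 2 := by
    have h : ∀ j, (x j - b) ^ 2 = (x j - groupMean x) ^ 2 +
        (2 * (groupMean x - b) * (x j - b) - (groupMean x - b) ^ 2) := fun j => by ring
    simp only [h]
    rw [Finset.sum_add_distrib, Finset.sum_sub_distrib, ← Finset.mul_sum, hsum, groupSS]
    simp
    ring
  rw [density, covOf_param (reCov_isSymm _ _), hmean, inv_reCov_mulVec hJ h₁ h₂,
    Real.log_mul (by positivity) (Real.exp_ne_zero _), Real.log_exp,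
      Real.log_inv, Real.log_sqrt (by positivity), Real.log_mul (by positivity) hdet.ne',
      det_reCov h₂.ne', Real.log_mul (by positivity) (by positivity),
      Real.log_div ha.ne' h₂.ne', Real.log_pow, Real.log_pow, hsum, mul_div_cancel_left₀ _ hJ'.ne']
  have hq : (fun j => x j - b) ⬝ᵥ (fun j => (x j - b - (groupMean x - b)) / s₂ +
      (groupMean x - b) / (s₂ + J * s₁)) =
      groupSS x / s₂ + J * (groupMean x - b) ^ 2 / (s₂ + J * s₁) := by
    have h : ∀ j, (x j - b) * ((x j - b - (groupMean x - b)) / s₂ +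
      (groupMean x - b) / (s₂ + J * s₁)) = (x j - b) ^ 2 / s₂ - (groupMean x - b) / s₂ * (x j - b)
        + (groupMean x - b) / (s₂ + J * s₁) * (x j - b) := fun j => by ring
    simp only [dotProduct, h]
    rw [Finset.sum_add_distrib, Finset.sum_sub_distrib, ← Finset.mul_sum, ← Finset.mul_sum, hsum,
      ← Finset.sum_div, hss]
    ring
  rw [hq]
  ring

/-- The within-group mean square. -/
noncomputable def withinMS (N : ℕ) (x : ℕ → Obs J) : ℝ :=
  (∑ i ∈ Finset.range N, groupSS (x i)) / (N * (J - 1))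

/-- The mean of all observations. -/
noncomputable def grandMean (N : ℕ) (x : ℕ → Obs J) : ℝ :=
  (∑ i ∈ Finset.range N, groupMean (x i)) / N

/-- The between-group mean square, normalized by the number of groups. -/
noncomputable def betweenMS (N : ℕ) (x : ℕ → Obs J) : ℝ :=
  J * (∑ i ∈ Finset.range N, (groupMean (x i) - grandMean N x) ^ 2) / N

lemma sum_sq_groupMean_sub {N : ℕ} (hN : 0 < N) (x : ℕ → Obs J) (b : ℝ) :
    J * ∑ i ∈ Finset.range N, (groupMean (x i) - b) ^ 2 =
      N * (betweenMS N x + J * (grandMean N x - b) ^ 2) := by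
  have hN' : (0 : ℝ) < N := Nat.cast_pos.2 hN
  have hsum : ∑ i ∈ Finset.range N, (groupMean (x i) - b) = N * (grandMean N x - b) := by
    rw [Finset.sum_sub_distrib, grandMean]
    simp
    field_simp
  have h : ∀ i, (groupMean (x i) - b) ^ 2 = (groupMean (x i) - grandMean N x) ^ 2 +
      (2 * (grandMean N x - b) * (groupMean (x i) - b) - (grandMean N x - b) ^ 2) :=
    fun i => by ring
  simp only [h]
  rw [Finset.sum_add_distrib, Finset.sum_sub_distrib, ← Finset.mul_sum, hsum, betweenMS]
  simp
  field_simp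
  ring

/-- The deviance separates into a function of `s₂` and a function of `s₂ + J * s₁`, so only the
ordering of these two quantities couples them. -/
lemma logLik_reCov (hJ : 2 ≤ J) {N : ℕ} (hN : 0 < N) (x : ℕ → Obs J) {s₁ s₂ : ℝ} (h₁ : 0 ≤ s₁)
    (h₂ : 0 < s₂) (b : ℝ) :
    logLik N x (param (reCov J s₁ s₂) b) =
      -(N * (J * Real.log (2 * Real.pi) + (J - 1) * (Real.log s₂ + withinMS N x / s₂) +
        (Real.log (s₂ + J * s₁) + (betweenMS N x + J * (grandMean N x - b) ^ 2)
          / (s₂ + J * s₁)))) / 2 := by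
  have hN' : (0 : ℝ) < N := Nat.cast_pos.2 hN
  have hJ' : (2 : ℝ) ≤ J := by exact_mod_cast hJ
  have hJ1 : (J : ℝ) - 1 ≠ 0 := by linarith
  have ha : 0 < s₂ + J * s₁ := by positivity
  have hb := sum_sq_groupMean_sub hN x b
  have hw : ∑ i ∈ Finset.range N, groupSS (x i) = N * (J - 1) * withinMS N x := by
    rw [withinMS]; field_simp
  simp only [logLik, log_density_reCov (by omega : 0 < J) h₁ h₂]
  rw [← Finset.sum_div, Finset.sum_neg_distrib]
  simp only [Finset.sum_add_distrib, ← Finset.sum_div, ← Finset.mul_sum]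
  rw [hb, hw]
  simp
  field_simp
  ring

/-! ### Maximization of the likelihood -/

/-- This is `log r ≤ r - 1` at `r = p / s`. The free reference point `p` is needed in the pooled
case, where both terms are compared at a common value. -/
lemma log_add_div_ge {p s : ℝ} (hp : 0 < p) (hs : 0 < s) (u : ℝ) :
    Real.log p + 1 + (u - p) / s ≤ Real.log s + u / s := by
  have h := Real.log_le_sub_one_of_pos (div_pos hp hs)
  rw [Real.log_div hp.ne' hs.ne'] at h
  rw [sub_div]
  linarith

/-- The minimal deviance per group of the random effects model, up to a constant. -/
noncomputable def minDev (J : ℕ) (u w : ℝ) : ℝ :=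
  if u ≤ w then (J - 1) * (Real.log u + 1) + (Real.log w + 1)
  else J * (Real.log (((J - 1) * u + w) / J) + 1)

/-- For `u ≤ w` each summand is bounded by its own free minimum. Otherwise both are compared at the
pooled value `p`, and the surplus `(p - w) * (1 / s - 1 / a)` is nonnegative because `w ≤ p` and `s
≤ a`. -/
lemma minDev_le (hJ : 2 ≤ J) {u w s a : ℝ} (hu : 0 < u) (hw : 0 ≤ w) (hs : 0 < s) (ha : s ≤ a) :
    minDev J u w ≤ (J - 1) * (Real.log s + u / s) + (Real.log a + w / a) := by
  have hJ' : (2 : ℝ) ≤ J := by exact_mod_cast hJ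
  have ha' := hs.trans_le ha
  rw [minDev]
  split_ifs with h
  · have h1 := log_add_div_ge hu hs u
    have h2 := log_add_div_ge (hu.trans_le h) ha' w
    rw [sub_self, zero_div, add_zero] at h1 h2
    have := mul_le_mul_of_nonneg_left h1 (by linarith : (0 : ℝ) ≤ J - 1)
    linarith
  · set p := ((J - 1) * u + w) / J with hp
    have hp0 : 0 < p := div_pos (by nlinarith) (by linarith)
    have hpe : J * p = (J - 1) * u + w := by rw [hp]; field_simp
    have h1 := mul_le_mul_of_nonneg_left (log_add_div_ge hp0 hs u)
      (by linarith : (0 : ℝ) ≤ J - 1)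
    have h2 := log_add_div_ge hp0 ha' w
    have hwp : w ≤ p := by
      rw [hp, le_div_iff₀ (by linarith)]
      nlinarith
    have h3 : 0 ≤ (p - w) * (1 / s - 1 / a) :=
      mul_nonneg (by linarith) (sub_nonneg.2 (one_div_le_one_div_of_le hs ha))
    have h4 : (J - 1) * ((u - p) / s) + (w - p) / a = (p - w) * (1 / s - 1 / a) := by
      have : (J - 1) * (u - p) = p - w := by linarith
      rw [← mul_div_assoc, this]
      ring
    linarith

lemma betweenMS_nonneg (N : ℕ) (x : ℕ → Obs J) : 0 ≤ betweenMS N x := by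
  rw [betweenMS]
  positivity

lemma logLik_le (hJ : 2 ≤ J) {N : ℕ} (hN : 0 < N) {x : ℕ → Obs J} (hx : 0 < withinMS N x)
    {η : Param J} (hη : η ∈ Theta1 J) :
    logLik N x η ≤ -(N * (J * Real.log (2 * Real.pi) +
      minDev J (withinMS N x) (betweenMS N x))) / 2 := by
  obtain ⟨s₁, s₂, b, h₁, h₂, rfl⟩ := hη
  have hN' : (0 : ℝ) < N := Nat.cast_pos.2 hN
  rw [logLik_reCov hJ hN x h₁ h₂]
  have ha : s₂ ≤ s₂ + J * s₁ := le_add_of_nonneg_right (by positivity)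
  have h := minDev_le hJ hx (betweenMS_nonneg N x) h₂ ha
  have h2 : betweenMS N x / (s₂ + J * s₁) ≤
      (betweenMS N x + J * (grandMean N x - b) ^ 2) / (s₂ + J * s₁) := by
    gcongr
    exact le_add_of_nonneg_right (by positivity)
  have h3 : J * Real.log (2 * Real.pi) + minDev J (withinMS N x) (betweenMS N x) ≤
      J * Real.log (2 * Real.pi) + (J - 1) * (Real.log s₂ + withinMS N x / s₂) +
        (Real.log (s₂ + J * s₁) + (betweenMS N x + J * (grandMean N x - b) ^ 2)
          / (s₂ + J * s₁)) := by linarith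
  have := mul_le_mul_of_nonneg_left h3 hN'.le
  linarith

lemma isGreatest_logLik_theta1 (hJ : 2 ≤ J) {N : ℕ} (hN : 0 < N) {x : ℕ → Obs J}
    (hx : 0 < withinMS N x) :
    IsGreatest (logLik N x '' Theta1 J) (-(N * (J * Real.log (2 * Real.pi) +
      minDev J (withinMS N x) (betweenMS N x))) / 2) := by
  have hJ' : (2 : ℝ) ≤ J := by exact_mod_cast hJ
  have hw := betweenMS_nonneg N x
  refine ⟨?_, ?_⟩
  · rw [minDev]
    split_ifs with h
    · have hb := hx.trans_le h
      -- This choice of `s₁` makes `s₂ + J * s₁` equal to the between-group mean square.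
      refine ⟨_, ⟨(betweenMS N x - withinMS N x) / J, withinMS N x, grandMean N x,
        div_nonneg (by linarith) (by linarith), hx, rfl⟩, ?_⟩
      rw [logLik_reCov hJ hN x (div_nonneg (by linarith) (by linarith)) hx,
        mul_div_cancel₀ _ (by linarith : (J : ℝ) ≠ 0), add_sub_cancel, div_self hx.ne', sub_self]
      rw [show betweenMS N x + J * (0 : ℝ) ^ 2 = betweenMS N x by ring, div_self hb.ne']
      ring
    · have hp : 0 < ((J - 1) * withinMS N x + betweenMS N x) / J :=
        div_pos (by nlinarith) (by linarith)
      refine ⟨_, ⟨0, _, grandMean N x, le_rfl, hp, rfl⟩, ?_⟩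
      rw [logLik_reCov hJ hN x le_rfl hp, sub_self, mul_zero, add_zero]
      have : (J - 1) * withinMS N x + betweenMS N x ≠ 0 := by
        intro h0; rw [h0, zero_div] at hp; exact lt_irrefl _ hp
      field_simp
      ring
  · rintro _ ⟨η, hη, rfl⟩
    exact logLik_le hJ hN hx hη

lemma isGreatest_logLik_theta0 (hJ : 2 ≤ J) {N : ℕ} (hN : 0 < N) {x : ℕ → Obs J}
    (hx : 0 < withinMS N x) :
    IsGreatest (logLik N x '' Theta0 J) (-(N * (J * Real.log (2 * Real.pi) +
      J * (Real.log (((J - 1) * withinMS N x + betweenMS N x) / J) + 1))) / 2) := by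
  have hJ' : (2 : ℝ) ≤ J := by exact_mod_cast hJ
  have hN' : (0 : ℝ) < N := Nat.cast_pos.2 hN
  have hw := betweenMS_nonneg N x
  have hp : 0 < ((J - 1) * withinMS N x + betweenMS N x) / J :=
    div_pos (by nlinarith) (by linarith)
  have h0 : (J - 1) * withinMS N x + betweenMS N x ≠ 0 := by
    intro h0; rw [h0, zero_div] at hp; exact lt_irrefl _ hp
  refine ⟨⟨_, ⟨_, grandMean N x, hp, rfl⟩, ?_⟩, ?_⟩
  · rw [← reCov_zero, logLik_reCov hJ hN x le_rfl hp, sub_self, mul_zero, add_zero]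
    field_simp
    ring
  · rintro _ ⟨_, ⟨s, b, hs, rfl⟩, rfl⟩
    rw [← reCov_zero, logLik_reCov hJ hN x le_rfl hs, mul_zero, add_zero]
    set p := ((J - 1) * withinMS N x + betweenMS N x) / J with hpdef
    have h1 := mul_le_mul_of_nonneg_left (log_add_div_ge hp hs p) (by linarith : (0 : ℝ) ≤ J)
    have h2 : J * (p / s) = (J - 1) * (withinMS N x / s) + betweenMS N x / s := by
      rw [hpdef]; field_simp
    have h3 : betweenMS N x / s ≤ (betweenMS N x + J * (grandMean N x - b) ^ 2) / s := by
      gcongr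
      exact le_add_of_nonneg_right (by positivity)
    rw [sub_self, zero_div, add_zero, mul_add (J : ℝ) (Real.log s)] at h1
    have h4 : J * Real.log (2 * Real.pi) + J * (Real.log p + 1) ≤
      J * Real.log (2 * Real.pi) + (J - 1) * (Real.log s + withinMS N x / s) +
        (Real.log s + (betweenMS N x + J * (grandMean N x - b) ^ 2) / s) := by linarith
    have := mul_le_mul_of_nonneg_left h4 hN'.le
    linarith

lemma lrt_eq (hJ : 2 ≤ J) {N : ℕ} (hN : 0 < N) {x : ℕ → Obs J} (hx : 0 < withinMS N x) :
    lrt N x = if withinMS N x ≤ betweenMS N x then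
      N * (J * Real.log (1 + (betweenMS N x / withinMS N x - 1) / J) -
        Real.log (1 + (betweenMS N x / withinMS N x - 1))) else 0 := by
  have hJ' : (2 : ℝ) ≤ J := by exact_mod_cast hJ
  have hw := betweenMS_nonneg N x
  have hpn : 0 < (J - 1) * withinMS N x + betweenMS N x := by nlinarith
  rw [lrt, (isGreatest_logLik_theta1 hJ hN hx).csSup_eq,
    (isGreatest_logLik_theta0 hJ hN hx).csSup_eq, minDev]
  split_ifs with h
  · have hb := hx.trans_le h
    rw [show 1 + (betweenMS N x / withinMS N x - 1) / J =
      (((J - 1) * withinMS N x + betweenMS N x) / J) / withinMS N x by field_simp; ring,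
      add_sub_cancel, Real.log_div hb.ne' hx.ne', Real.log_div (by positivity) hx.ne']
    ring
  · ring

/-! ### Second order expansion of the likelihood ratio -/

/-- `(log (1 + x) - x) / x²`, extended continuously to `0`. -/
noncomputable def logRem (x : ℝ) : ℝ := if x = 0 then -(1 / 2) else (Real.log (1 + x) - x) / x ^ 2

lemma sq_mul_logRem (x : ℝ) : x ^ 2 * logRem x = Real.log (1 + x) - x := by
  rw [logRem]
  split_ifs with h
  · simp [h]
  · field_simp

lemma measurable_logRem : Measurable logRem :=
  Measurable.ite (measurableSet_singleton 0) measurable_const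
    (((Real.measurable_log.comp (measurable_const.add measurable_id)).sub measurable_id).div
      (measurable_id.pow_const 2))

lemma abs_logRem_add_half_le {x : ℝ} (hx : |x| < 1) :
    |logRem x + 1 / 2| ≤ |x| / (1 - |x|) := by
  have h1 : 0 < 1 - |x| := by linarith
  rw [logRem]
  split_ifs with h
  · simp [h]
  · have h2 := Real.abs_log_sub_add_sum_range_le (x := -x) (by rwa [abs_neg]) 2
    rw [abs_neg, sub_neg_eq_add] at h2
    simp only [Finset.sum_range_succ, Finset.sum_range_zero] at h2
    have hx2 : 0 < |x| ^ 2 := by positivity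
    have e : (Real.log (1 + x) - x) / x ^ 2 + 1 / 2 = (Real.log (1 + x) - x + x ^ 2 / 2) / x ^ 2 := by
      field_simp
    rw [e, abs_div, abs_pow, div_le_iff₀ hx2]
    calc |Real.log (1 + x) - x + x ^ 2 / 2| ≤ |x| ^ (2 + 1) / (1 - |x|) := by
          convert h2 using 2
          norm_num; ring
      _ = |x| / (1 - |x|) * |x| ^ 2 := by ring

lemma tendsto_logRem : Tendsto logRem (𝓝 0) (𝓝 (-(1 / 2))) := by
  rw [tendsto_iff_dist_tendsto_zero]
  have h0 : Tendsto (fun x : ℝ => |x| / (1 - |x|)) (𝓝 0) (𝓝 0) := by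
    have : ContinuousAt (fun x : ℝ => |x| / (1 - |x|)) 0 :=
      ContinuousAt.div (by fun_prop) (by fun_prop) (by simp)
    simpa [ContinuousAt] using this
  refine squeeze_zero' (Eventually.of_forall fun _ => dist_nonneg) ?_ h0
  have : ∀ᶠ x : ℝ in 𝓝 0, |x| < 1 := by
    have := Metric.ball_mem_nhds (0 : ℝ) one_pos
    filter_upwards [this] with x hx
    simpa using hx
  filter_upwards [this] with x hx
  rw [Real.dist_eq, sub_neg_eq_add]
  exact abs_logRem_add_half_le hx

/-- The ratio of the likelihood ratio to its quadratic approximation. -/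
noncomputable def quadRatio (J : ℕ) (x : ℝ) : ℝ := logRem (x / J) / J - logRem x

lemma sq_mul_quadRatio (hJ : 0 < J) (x : ℝ) :
    x ^ 2 * quadRatio J x = J * Real.log (1 + x / J) - Real.log (1 + x) := by
  have hJ' : (0 : ℝ) < J := Nat.cast_pos.2 hJ
  have h1 := sq_mul_logRem x
  have h2 := sq_mul_logRem (x / J)
  have h3 : x ^ 2 * (logRem (x / J) / J) = J * ((x / J) ^ 2 * logRem (x / J)) := by
    field_simp
  rw [quadRatio, mul_sub, h3, h1, h2]
  field_simp
  ring

lemma measurable_quadRatio : Measurable (quadRatio J) :=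
  ((measurable_logRem.comp (measurable_id.div_const _)).div_const _).sub measurable_logRem

lemma tendsto_quadRatio : Tendsto (quadRatio J) (𝓝 0) (𝓝 (-(1 / 2) / J - -(1 / 2))) := by
  refine Tendsto.sub (Tendsto.div_const (tendsto_logRem.comp ?_) _) tendsto_logRem
  have : ContinuousAt (fun x : ℝ => x / J) 0 := by fun_prop
  simpa [ContinuousAt] using this

/-- Separates the asymptotically normal quantity from a factor that converges almost surely, in the
form required by Slutsky's lemma. -/
lemma lrt_eq_posSq (hJ : 2 ≤ J) {N : ℕ} (hN : 0 < N) {x : ℕ → Obs J} (hx : 0 < withinMS N x) :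
    lrt N x = posSq (√N * (betweenMS N x - withinMS N x)) *
      (quadRatio J (betweenMS N x / withinMS N x - 1) / withinMS N x ^ 2) := by
  have hN' : (0 : ℝ) < √N := Real.sqrt_pos.2 (Nat.cast_pos.2 hN)
  rw [lrt_eq hJ hN hx, ← sq_mul_quadRatio (by omega), posSq]
  simp only [mul_nonneg_iff_of_pos_left hN', sub_nonneg]
  split_ifs
  · rw [mul_pow, Real.sq_sqrt (Nat.cast_nonneg N)]
    field_simp
  · ring

/-! ### The group statistics under the null hypothesis -/

lemma measurable_groupMean : Measurable (groupMean : Obs J → ℝ) := by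
  unfold groupMean; fun_prop

lemma measurable_groupSS : Measurable (groupSS : Obs J → ℝ) := by
  unfold groupSS groupMean; fun_prop

/-- The difference of the two mean squares contributed by one group. -/
noncomputable def groupDiff (b : ℝ) (x : Obs J) : ℝ :=
  J * (groupMean x - b) ^ 2 - groupSS x / (J - 1)

lemma measurable_groupDiff (b : ℝ) : Measurable (groupDiff b : Obs J → ℝ) :=
  ((measurable_groupMean.sub_const b).pow_const 2 |>.const_mul _).sub
    (measurable_groupSS.div_const _)

lemma groupMean_sub (hJ : 0 < J) (b : ℝ) (y : Fin J → ℝ) :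
    groupMean (WithLp.toLp 2 fun j => b + y j) - b = (∑ j, y j) / J := by
  have hJ' : (0 : ℝ) < J := Nat.cast_pos.2 hJ
  simp only [groupMean, Finset.sum_add_distrib]
  simp
  field_simp
  ring

lemma groupSS_eq (hJ : 0 < J) (b : ℝ) (y : Fin J → ℝ) :
    groupSS (WithLp.toLp 2 fun j => b + y j) = ∑ j, y j ^ 2 - (∑ j, y j) ^ 2 / J := by
  have hJ' : (0 : ℝ) < J := Nat.cast_pos.2 hJ
  have h := groupMean_sub hJ b y
  have h2 : ∀ j, (b + y j - groupMean (WithLp.toLp 2 fun j => b + y j)) ^ 2 =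
      y j ^ 2 - 2 * ((∑ j, y j) / J) * y j + ((∑ j, y j) / J) ^ 2 := fun j => by
    rw [← h]; ring
  simp only [groupSS, h2]
  rw [Finset.sum_add_distrib, Finset.sum_sub_distrib, ← Finset.mul_sum]
  simp
  field_simp
  ring

/-- The squares `y j ^ 2` cancel, so only products of distinct coordinates remain and the second
moment follows from `integral_noise_fourth`. -/
lemma groupDiff_eq (hJ : 2 ≤ J) (b : ℝ) (y : Fin J → ℝ) :
    groupDiff b (WithLp.toLp 2 fun j => b + y j) =
      (∑ p ∈ (Finset.univ : Finset (Fin J)).offDiag, y p.1 * y p.2) / (J - 1) := by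
  have hJ' : (2 : ℝ) ≤ J := by exact_mod_cast hJ
  have hJ1 : (J : ℝ) - 1 ≠ 0 := by linarith
  have h : ∑ p ∈ (Finset.univ : Finset (Fin J)).offDiag, y p.1 * y p.2 =
      (∑ j, y j) ^ 2 - ∑ j, y j ^ 2 := by
    rw [sq, Finset.sum_mul_sum, ← Finset.sum_product', ← Finset.diag_union_offDiag,
      Finset.sum_union (Finset.disjoint_diag_offDiag _), Finset.sum_diag]
    simp [sq]
  rw [groupDiff, groupMean_sub (by omega), groupSS_eq (by omega), h]
  field_simp
  ring

lemma memLp_noise_mul (v : ℝ≥0) (i j : Fin J) :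
    MemLp (fun y : Fin J → ℝ => y i * y j) 2 (noise J v) := by
  have h : ENNReal.HolderTriple 4 4 2 := ⟨by
    rw [← two_mul, show (4 : ℝ≥0∞) = 2 * 2 by norm_num, ENNReal.mul_inv (by simp) (by simp),
      ← mul_assoc, ENNReal.mul_inv_cancel (by simp) (by simp), one_mul]⟩
  have h4 : ∀ k : Fin J, MemLp (fun y : Fin J → ℝ => y k) 4 (noise J v) := fun k => by
    simpa using memLp_noise_eval v k 4
  exact (h4 j).mul' (h4 i)

lemma integral_noise_sum_sq_eval (v : ℝ≥0) : ∫ y, ∑ j, y j ^ 2 ∂(noise J v) = J * v := by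
  rw [integral_finsetSum _ fun i _ => (memLp_noise_eval v i 2).integrable_sq]
  simp [integral_noise_eval _ (f := fun x : ℝ => x ^ 2) (by fun_prop), integral_sq_gaussianReal]

/-- Each of the `J * (J - 1)` ordered pairs correlates only with itself and its transpose. -/
lemma integral_offDiag_sq (v : ℝ≥0) :
    ∫ y, (∑ p ∈ (Finset.univ : Finset (Fin J)).offDiag, y p.1 * y p.2) ^ 2 ∂(noise J v) =
      2 * (J * (J - 1)) * (v : ℝ) ^ 2 := by
  simp only [sq (∑ p ∈ _, _), Finset.sum_mul_sum]
  have hint : ∀ p q : Fin J × Fin J, Integrable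
      (fun y : Fin J → ℝ => (y p.1 * y p.2) * (y q.1 * y q.2)) (noise J v) := fun p q =>
    (memLp_noise_mul v p.1 p.2).integrable_mul (memLp_noise_mul v q.1 q.2)
  rw [integral_finsetSum _ fun p _ => integrable_finsetSum _ fun q _ => hint p q]
  have h : ∀ p ∈ (Finset.univ : Finset (Fin J)).offDiag,
      ∫ y, ∑ q ∈ (Finset.univ : Finset (Fin J)).offDiag, (y p.1 * y p.2) * (y q.1 * y q.2)
        ∂(noise J v) = 2 * (v : ℝ) ^ 2 := by
    rintro ⟨i, j⟩ hp
    have hij : i ≠ j := by simpa using hp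
    rw [integral_finsetSum _ fun q _ => hint (i, j) q]
    simp only [integral_noise_fourth hij]
    rw [← Finset.sum_filter, Finset.sum_const, nsmul_eq_mul]
    have : (Finset.univ : Finset (Fin J)).offDiag.filter
        (fun q => (q.1 = i ∧ q.2 = j) ∨ (q.1 = j ∧ q.2 = i)) = {(i, j), (j, i)} := by
      ext ⟨k, l⟩
      simp only [Finset.mem_filter, Finset.mem_offDiag, Finset.mem_univ, true_and,
        Finset.mem_insert, Finset.mem_singleton, Prod.mk.injEq]
      grind
    rw [this, Finset.card_pair (by simp [hij])]
    norm_num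
  rw [Finset.sum_congr rfl h, Finset.sum_const, Finset.offDiag_card, nsmul_eq_mul,
    Nat.cast_sub (by simpa using Nat.le_mul_self J)]
  simp
  ring

/-- Covers the index `N = 0`, where the closed formula for the statistic is not available. -/
lemma lrt_zero (x : ℕ → Obs J) : lrt 0 x = 0 := by
  have h0 : (Theta0 J).Nonempty := ⟨_, 1, 0, one_pos, rfl⟩
  have h1 : (Theta1 J).Nonempty := h0.mono theta0_subset_theta1
  have hl : logLik 0 x = fun _ => 0 := by ext; simp [logLik]
  rw [lrt, hl, h0.image_const, h1.image_const, sub_self, mul_zero]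

section Asymptotics

variable {b : ℝ} {v : ℝ≥0} {Ω : Type*} [MeasurableSpace Ω] {P : Measure Ω}

/-! ### Asymptotics of the likelihood ratio statistic -/

lemma integral_comp_group {X : Ω → Obs J} (hX : HasLaw X (reLaw J b 0 v) P) {f : Obs J → ℝ}
    (hf : Measurable f) :
    ∫ ω, f (X ω) ∂P = ∫ y, f (WithLp.toLp 2 fun j => b + y j) ∂(noise J v) := by
  have h := hX.integral_comp (f := f) hf.aestronglyMeasurable
  rw [reLaw_zero, integral_map (Measurable.aemeasurable (by fun_prop)) hf.aestronglyMeasurable] at h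
  exact h

lemma memLp_comp_group {X : Ω → Obs J} (hX : HasLaw X (reLaw J b 0 v) P) {f : Obs J → ℝ}
    (hf : Measurable f) {p : ℝ≥0∞}
    (h : MemLp (fun y : Fin J → ℝ => f (WithLp.toLp 2 fun j => b + y j)) p (noise J v)) :
    MemLp (fun ω => f (X ω)) p P := by
  refine (memLp_map_measure_iff (f := X) hf.aestronglyMeasurable hX.aemeasurable).1 ?_
  rw [hX.map_eq, reLaw_zero, memLp_map_measure_iff hf.aestronglyMeasurable
    (Measurable.aemeasurable (by fun_prop))]
  exact h

lemma memLp_groupMean_sub (hJ : 0 < J) {X : Ω → Obs J} (hX : HasLaw X (reLaw J b 0 v) P) :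
    MemLp (fun ω => groupMean (X ω) - b) 2 P := by
  refine memLp_comp_group hX (f := fun x => groupMean x - b) (measurable_groupMean.sub_const b) ?_
  simp only [groupMean_sub hJ, div_eq_inv_mul]
  exact (memLp_noise_sum v 2).const_mul _

lemma integral_groupMean_sub (hJ : 0 < J) {X : Ω → Obs J} (hX : HasLaw X (reLaw J b 0 v) P) :
    ∫ ω, groupMean (X ω) - b ∂P = 0 := by
  rw [integral_comp_group hX (f := fun x => groupMean x - b) (measurable_groupMean.sub_const b)]
  simp only [groupMean_sub hJ]
  rw [integral_div, integral_noise_sum, zero_div]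

lemma integral_groupMean_sub_sq (hJ : 0 < J) {X : Ω → Obs J} (hX : HasLaw X (reLaw J b 0 v) P) :
    ∫ ω, (groupMean (X ω) - b) ^ 2 ∂P = v / J := by
  have hJ' : (0 : ℝ) < J := Nat.cast_pos.2 hJ
  rw [integral_comp_group hX (f := fun x => (groupMean x - b) ^ 2)
    ((measurable_groupMean.sub_const b).pow_const 2)]
  simp only [groupMean_sub hJ, div_pow]
  rw [integral_div, integral_noise_sum_sq]
  field_simp

lemma integrable_groupSS (hJ : 0 < J) {X : Ω → Obs J} (hX : HasLaw X (reLaw J b 0 v) P) :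
    Integrable (fun ω => groupSS (X ω)) P := by
  rw [← memLp_one_iff_integrable]
  refine memLp_comp_group hX measurable_groupSS ?_
  simp only [groupSS_eq hJ]
  rw [memLp_one_iff_integrable]
  exact (integrable_finsetSum _ fun i _ => (memLp_noise_eval v i 2).integrable_sq).sub
    ((memLp_noise_sum v 2).integrable_sq.div_const _)

lemma integral_groupSS (hJ : 0 < J) {X : Ω → Obs J} (hX : HasLaw X (reLaw J b 0 v) P) :
    ∫ ω, groupSS (X ω) ∂P = (J - 1) * v := by
  have hJ' : (0 : ℝ) < J := Nat.cast_pos.2 hJ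
  rw [integral_comp_group hX measurable_groupSS]
  simp only [groupSS_eq hJ]
  rw [integral_sub (integrable_finsetSum _ fun i _ => (memLp_noise_eval v i 2).integrable_sq)
    ((memLp_noise_sum v 2).integrable_sq.div_const _), integral_noise_sum_sq_eval, integral_div,
    integral_noise_sum_sq]
  field_simp

lemma integral_groupDiff (hJ : 2 ≤ J) {X : Ω → Obs J} (hX : HasLaw X (reLaw J b 0 v) P) :
    ∫ ω, groupDiff b (X ω) ∂P = 0 := by
  have hJ' : (2 : ℝ) ≤ J := by exact_mod_cast hJ
  have hJ1 : (J : ℝ) - 1 ≠ 0 := by linarith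
  simp only [groupDiff]
  rw [integral_sub ((memLp_groupMean_sub (by omega) hX).integrable_sq.const_mul _)
    ((integrable_groupSS (by omega) hX).div_const _), integral_const_mul, integral_div,
    integral_groupMean_sub_sq (by omega) hX, integral_groupSS (by omega) hX]
  field_simp
  ring

lemma integral_groupDiff_sq (hJ : 2 ≤ J) {X : Ω → Obs J} (hX : HasLaw X (reLaw J b 0 v) P) :
    ∫ ω, groupDiff b (X ω) ^ 2 ∂P = 2 * J * v ^ 2 / (J - 1) := by
  have hJ' : (2 : ℝ) ≤ J := by exact_mod_cast hJ
  have hJ1 : (J : ℝ) - 1 ≠ 0 := by linarith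
  rw [integral_comp_group hX (f := fun x => groupDiff b x ^ 2)
    ((measurable_groupDiff b).pow_const 2)]
  simp only [groupDiff_eq hJ, div_pow]
  rw [integral_div, integral_offDiag_sq]
  field_simp

/-- Almost surely, the observations of a group are not all equal. -/
lemma ae_groupSS_pos (hJ : 2 ≤ J) (hv : 0 < v) {X : Ω → Obs J}
    (hX : HasLaw X (reLaw J b 0 v) P) : ∀ᵐ ω ∂P, 0 < groupSS (X ω) := by
  obtain ⟨i, j, hij⟩ := exists_lt_fin hJ
  have hac : reLaw J b 0 v ≪ volume := by
    rw [reLaw_eq_model, model_eq_withDensity]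
    · exact withDensity_absolutelyContinuous _ _
    · exact ⟨_, _, posDef_reCov le_rfl (NNReal.coe_pos.2 hv), rfl⟩
  -- The hyperplane `x i = x j` is Lebesgue null, and a vanishing `groupSS` places `x` in it.
  let S : Submodule ℝ (Obs J) := LinearMap.ker
    ((EuclideanSpace.proj i : Obs J →L[ℝ] ℝ) - EuclideanSpace.proj j : Obs J →L[ℝ] ℝ).toLinearMap
  have hS : S ≠ ⊤ := by
    intro h
    have : EuclideanSpace.single i (1 : ℝ) ∈ S := by rw [h]; trivial
    simp [S, hij.ne'] at this
  have h0 : volume (S : Set (Obs J)) = 0 := Measure.addHaar_submodule _ S hS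
  have h1 : ∀ᵐ x ∂(reLaw J b 0 v), x ∉ S := hac.ae_le (measure_eq_zero_iff_ae_notMem.1 h0)
  have h2 : ∀ᵐ x ∂(reLaw J b 0 v), 0 < groupSS x := by
    filter_upwards [h1] with x hx
    refine (Finset.sum_nonneg fun _ _ => sq_nonneg _).lt_of_ne fun h => hx ?_
    have h3 := (Finset.sum_eq_zero_iff_of_nonneg fun _ _ => sq_nonneg _).1 h.symm
    have hi := h3 i (Finset.mem_univ _)
    have hj := h3 j (Finset.mem_univ _)
    rw [sq_eq_zero_iff, sub_eq_zero] at hi hj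
    change x i - x j = 0
    rw [hi, hj, sub_self]
  rw [← hX.map_eq] at h2
  exact ae_of_ae_map hX.aemeasurable h2

variable {X : ℕ → Ω → Obs J}

lemma ae_withinMS_pos (hJ : 2 ≤ J) (hv : 0 < v) (hX : ∀ i, HasLaw (X i) (reLaw J b 0 v) P) :
    ∀ᵐ ω ∂P, ∀ N : ℕ, 0 < N → 0 < withinMS N (fun i => X i ω) := by
  have hJ' : (2 : ℝ) ≤ J := by exact_mod_cast hJ
  filter_upwards [ae_groupSS_pos hJ hv (hX 0)] with ω hω N hN
  have hN' : (0 : ℝ) < N := Nat.cast_pos.2 hN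
  refine div_pos (Finset.sum_pos' (fun i _ => Finset.sum_nonneg fun _ _ => sq_nonneg _)
    ⟨0, Finset.mem_range.2 hN, hω⟩) (mul_pos hN' (by linarith))

lemma betweenMS_eq {N : ℕ} (hN : 0 < N) (x : ℕ → Obs J) (b : ℝ) :
    betweenMS N x = J * ((∑ i ∈ Finset.range N, (groupMean (x i) - b) ^ 2) / N) -
      J * ((∑ i ∈ Finset.range N, (groupMean (x i) - b)) / N) ^ 2 := by
  have hN' : (0 : ℝ) < N := Nat.cast_pos.2 hN
  have h := sum_sq_groupMean_sub hN x b
  have h2 : (∑ i ∈ Finset.range N, (groupMean (x i) - b)) / N = grandMean N x - b := by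
    rw [Finset.sum_sub_distrib, grandMean]
    simp
    field_simp
  rw [h2, mul_div_assoc', h]
  field_simp
  ring

/-- Centering at the true mean `b` instead of the grand mean gives a sum of i.i.d. terms, at the
price of a squared-mean remainder. -/
lemma sqrt_mul_sub_eq (hJ : 2 ≤ J) {N : ℕ} (hN : 0 < N) (x : ℕ → Obs J) (b : ℝ) :
    √N * (betweenMS N x - withinMS N x) = (√N)⁻¹ * ∑ i ∈ Finset.range N, groupDiff b (x i) -
      √N * (J * ((∑ i ∈ Finset.range N, (groupMean (x i) - b)) / N) ^ 2) := by
  have hJ' : (2 : ℝ) ≤ J := by exact_mod_cast hJ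
  have hJ1 : (J : ℝ) - 1 ≠ 0 := by linarith
  have hN' : (0 : ℝ) < N := Nat.cast_pos.2 hN
  have hs : (√N)⁻¹ = √N / (N : ℝ) := by
    rw [inv_eq_one_div, div_eq_div_iff (by positivity) (by positivity), one_mul,
      Real.mul_self_sqrt hN'.le]
  rw [betweenMS_eq hN x b, hs, withinMS]
  simp only [groupDiff, Finset.sum_sub_distrib, ← Finset.mul_sum, ← Finset.sum_div]
  field_simp
  ring

lemma identDistrib_comp {f : Obs J → ℝ} (hf : Measurable f)
    (hX : ∀ i, HasLaw (X i) (reLaw J b 0 v) P) (i : ℕ) :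
    IdentDistrib (fun ω => f (X i ω)) (fun ω => f (X 0 ω)) P P :=
  IdentDistrib.comp ⟨(hX i).aemeasurable, (hX 0).aemeasurable,
    by rw [(hX i).map_eq, (hX 0).map_eq]⟩ hf

lemma strong_law_comp {f : Obs J → ℝ} (hf : Measurable f)
    (hX : ∀ i, HasLaw (X i) (reLaw J b 0 v) P) (hind : iIndepFun X P)
    (hint : Integrable (fun ω => f (X 0 ω)) P) :
    ∀ᵐ ω ∂P, Tendsto (fun n : ℕ => (∑ i ∈ Finset.range n, f (X i ω)) / n) atTop
      (𝓝 (∫ ω, f (X 0 ω) ∂P)) :=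
  strong_law_ae_real (fun i ω => f (X i ω)) hint
    (fun _ _ hij => (hind.comp (fun _ => f) (fun _ => hf)).indepFun hij) (identDistrib_comp hf hX)

lemma aemeasurable_withinMS (hX : ∀ i, AEMeasurable (X i) P) (N : ℕ) :
    AEMeasurable (fun ω => withinMS N (fun i => X i ω)) P :=
  (Finset.aemeasurable_fun_sum _ fun i _ => measurable_groupSS.comp_aemeasurable (hX i)).div_const _

lemma aemeasurable_betweenMS (hX : ∀ i, AEMeasurable (X i) P) (N : ℕ) :
    AEMeasurable (fun ω => betweenMS N (fun i => X i ω)) P := by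
  have hg : ∀ i, AEMeasurable (fun ω => groupMean (X i ω)) P := fun i =>
    measurable_groupMean.comp_aemeasurable (hX i)
  have hm : AEMeasurable (fun ω => grandMean N (fun i => X i ω)) P :=
    (Finset.aemeasurable_fun_sum _ fun i _ => hg i).div_const _
  exact ((Finset.aemeasurable_fun_sum _ fun i _ =>
    ((hg i).sub hm).pow_const 2).const_mul _).div_const _

lemma tendstoInMeasure_const_mul {f : ℕ → Ω → ℝ} (h : TendstoInMeasure P f atTop 0) {c : ℝ}
    (hc : c ≠ 0) : TendstoInMeasure P (fun n ω => c * f n ω) atTop 0 := by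
  rw [tendstoInMeasure_iff_norm] at h ⊢
  intro ε hε
  refine (h (ε / ‖c‖) (div_pos hε (norm_pos_iff.2 hc))).congr fun n => ?_
  congr 1
  ext ω
  simp only [Pi.zero_apply, sub_zero, Set.mem_ofPred_eq, norm_mul]
  rw [div_le_iff₀' (norm_pos_iff.2 hc)]

variable [IsProbabilityMeasure P]

lemma ae_tendsto_meanSquares (hJ : 2 ≤ J) (hX : ∀ i, HasLaw (X i) (reLaw J b 0 v) P)
    (hind : iIndepFun X P) :
    ∀ᵐ ω ∂P, Tendsto (fun N => withinMS N (fun i => X i ω)) atTop (𝓝 v) ∧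
      Tendsto (fun N => betweenMS N (fun i => X i ω)) atTop (𝓝 v) := by
  have hJ' : (2 : ℝ) ≤ J := by exact_mod_cast hJ
  have hJ1 : (J : ℝ) - 1 ≠ 0 := by linarith
  have h1 := strong_law_comp measurable_groupSS hX hind (integrable_groupSS (by omega) (hX 0))
  have h2 := strong_law_comp (f := fun x => groupMean x - b) (measurable_groupMean.sub_const b)
    hX hind ((memLp_groupMean_sub (by omega) (hX 0)).integrable (by simp))
  have h3 := strong_law_comp (f := fun x => (groupMean x - b) ^ 2)
    ((measurable_groupMean.sub_const b).pow_const 2)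
    hX hind (memLp_groupMean_sub (by omega) (hX 0)).integrable_sq
  rw [integral_groupSS (by omega) (hX 0)] at h1
  rw [integral_groupMean_sub (by omega) (hX 0)] at h2
  rw [integral_groupMean_sub_sq (by omega) (hX 0)] at h3
  filter_upwards [h1, h2, h3] with ω h1 h2 h3
  constructor
  · have := h1.div_const ((J : ℝ) - 1)
    rw [mul_div_cancel_left₀ _ hJ1] at this
    refine this.congr fun N => ?_
    rw [withinMS, div_div]
  · have := (h3.const_mul (J : ℝ)).sub ((h2.pow 2).const_mul (J : ℝ))
    rw [mul_div_cancel₀ _ (by linarith : (J : ℝ) ≠ 0)] at this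
    have h0 : (v : ℝ) - J * 0 ^ 2 = v := by ring
    rw [h0] at this
    refine this.congr' ?_
    filter_upwards [eventually_gt_atTop 0] with N hN
    rw [betweenMS_eq hN _ b]

/-- The squared mean of centered square integrable variables is of order `1 / N`. -/
lemma integral_sum_groupMean_sq (hJ : 0 < J) (hX : ∀ i, HasLaw (X i) (reLaw J b 0 v) P)
    (hind : iIndepFun X P) (N : ℕ) :
    ∫ ω, (∑ i ∈ Finset.range N, (groupMean (X i ω) - b)) ^ 2 ∂P = N * (v / J) := by
  set M : ℕ → Ω → ℝ := fun i ω => groupMean (X i ω) - b with hM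
  have hL : ∀ i, MemLp (M i) 2 P := fun i => memLp_groupMean_sub hJ (hX i)
  have h := IndepFun.variance_sum (X := M) (s := Finset.range N) (μ := P) (fun i _ => hL i)
    (fun i _ j _ hij => (hind.comp (fun _ x => groupMean x - b)
      (fun _ => measurable_groupMean.sub_const b)).indepFun hij)
  have hvar : ∀ i, variance (M i) P = v / J := fun i => by
    rw [variance_of_integral_eq_zero (hL i).aemeasurable (integral_groupMean_sub hJ (hX i))]
    exact integral_groupMean_sub_sq hJ (hX i)
  have hS : MemLp (∑ i ∈ Finset.range N, M i) 2 P := memLp_finsetSum' _ fun i _ => hL i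
  rw [variance_of_integral_eq_zero hS.aemeasurable] at h
  · simp only [hvar, Finset.sum_const, Finset.card_range, nsmul_eq_mul] at h
    rw [← h]
    refine integral_congr_ae (ae_of_all _ fun ω => ?_)
    simp [hM, Finset.sum_apply]
  · simp only [Finset.sum_apply]
    rw [integral_finsetSum _ fun i _ => (hL i).integrable (by simp)]
    exact Finset.sum_eq_zero fun i _ => integral_groupMean_sub hJ (hX i)

/-- The remainder is nonnegative with expectation `v / √N`, so it vanishes in `L¹`. -/
lemma tendstoInMeasure_remainder (hJ : 0 < J) (hX : ∀ i, HasLaw (X i) (reLaw J b 0 v) P)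
    (hind : iIndepFun X P) :
    TendstoInMeasure P (fun (N : ℕ) ω =>
      √N * (J * ((∑ i ∈ Finset.range N, (groupMean (X i ω) - b)) / N) ^ 2)) atTop 0 := by
  have hL : ∀ i, MemLp (fun ω => groupMean (X i ω) - b) 2 P :=
    fun i => memLp_groupMean_sub hJ (hX i)
  have hS : ∀ N : ℕ, MemLp (fun ω => ∑ i ∈ Finset.range N, (groupMean (X i ω) - b)) 2 P :=
    fun N => memLp_finsetSum _ fun i _ => hL i
  have hJ' : (0 : ℝ) < J := Nat.cast_pos.2 hJ
  have hm : ∀ N : ℕ, AEStronglyMeasurable (fun ω =>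
      √N * (J * ((∑ i ∈ Finset.range N, (groupMean (X i ω) - b)) / N) ^ 2)) P := fun N =>
    ((((hS N).aemeasurable.div_const _).pow_const 2).const_mul _ |>.const_mul _).aestronglyMeasurable
  refine tendstoInMeasure_of_tendsto_eLpNorm one_ne_zero hm aestronglyMeasurable_zero ?_
  have hint : ∀ N : ℕ, Integrable (fun ω =>
      √N * (J * ((∑ i ∈ Finset.range N, (groupMean (X i ω) - b)) / N) ^ 2)) P := fun N => by
    simp only [div_pow]
    exact ((hS N).integrable_sq.div_const _).const_mul _ |>.const_mul _
  have heq : ∀ N : ℕ, eLpNorm ((fun ω =>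
      √N * (J * ((∑ i ∈ Finset.range N, (groupMean (X i ω) - b)) / N) ^ 2)) - 0) 1 P =
      ENNReal.ofReal (v / √N) := fun N => by
    rw [sub_zero, eLpNorm_one_eq_lintegral_enorm,
      ← ofReal_integral_norm_eq_lintegral_enorm (hint N)]
    congr 1
    have : ∀ ω, ‖√N * (J * ((∑ i ∈ Finset.range N, (groupMean (X i ω) - b)) / N) ^ 2)‖ =
        √N * J / (N : ℝ) ^ 2 * (∑ i ∈ Finset.range N, (groupMean (X i ω) - b)) ^ 2 := fun ω => by
      rw [Real.norm_of_nonneg (by positivity)]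
      ring
    simp only [this]
    rw [integral_const_mul, integral_sum_groupMean_sq hJ hX hind]
    rcases Nat.eq_zero_or_pos N with rfl | hN
    · simp
    · have hN' : (0 : ℝ) < N := Nat.cast_pos.2 hN
      have hs : 0 < √(N : ℝ) := Real.sqrt_pos.2 hN'
      rw [eq_div_iff hs.ne']
      calc √(N : ℝ) * J / (N : ℝ) ^ 2 * (N * (v / J)) * √N
          = (√(N : ℝ) * √N) * v / N := by field_simp
        _ = v := by rw [Real.mul_self_sqrt hN'.le]; field_simp
  simp only [heq]
  rw [← ENNReal.ofReal_zero]
  refine ENNReal.tendsto_ofReal ?_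
  exact tendsto_const_nhds.div_atTop (Real.tendsto_sqrt_atTop.comp tendsto_natCast_atTop_atTop)

/-- The likelihood ratio statistic converges in distribution to `w² 1{w ≥ 0}`. -/
theorem tendstoInDistribution_lrt (hJ : 2 ≤ J) (hv : 0 < v)
    (hX : ∀ i, HasLaw (X i) (reLaw J b 0 v) P) (hind : iIndepFun X P) :
    TendstoInDistribution (fun (N : ℕ) ω => lrt N (fun i => X i ω)) atTop posSq (fun _ => P)
      (gaussianReal 0 1) := by
  have hJ' : (2 : ℝ) ≤ J := by exact_mod_cast hJ
  have hJ1 : (0 : ℝ) < J - 1 := by linarith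
  have hv' : (0 : ℝ) < v := NNReal.coe_pos.2 hv
  -- The standard deviation of `groupDiff b (X i)`.
  set s : ℝ := √(2 * J * v ^ 2 / (J - 1)) with hs
  have hs2 : s ^ 2 = 2 * J * v ^ 2 / (J - 1) := Real.sq_sqrt (by positivity)
  have hs0 : 0 < s := Real.sqrt_pos.2 (by positivity)
  have hXm : ∀ i, AEMeasurable (X i) P := fun i => (hX i).aemeasurable
  have hDm : Measurable (fun x : Obs J => groupDiff b x / s) := (measurable_groupDiff b).div_const s
  have hclt := tendstoInDistribution_inv_sqrt_mul_sum (P := P)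
    (X := fun i ω => groupDiff b (X i ω) / s) (Y := id) (P' := gaussianReal 0 1) HasLaw.id
    (by rw [integral_div, integral_groupDiff hJ (hX 0), zero_div])
    (by
      simp only [Pi.pow_apply, div_pow]
      rw [integral_div, integral_groupDiff_sq hJ (hX 0), ← hs2, div_self (by positivity)])
    (hind.comp (fun _ x => groupDiff b x / s) (fun _ => hDm))
    (identDistrib_comp hDm hX)
  have hrem := tendstoInMeasure_remainder (by omega) hX hind
  have hT : TendstoInDistribution (fun (N : ℕ) ω =>
      √N * (betweenMS N (fun i => X i ω) - withinMS N (fun i => X i ω)) / s) atTop id (fun _ => P)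
      (gaussianReal 0 1) := by
    refine tendstoInDistribution_of_tendstoInMeasure_sub _ _ hclt ?_ fun N =>
      (((aemeasurable_betweenMS hXm N).sub (aemeasurable_withinMS hXm N)).const_mul _).div_const _
    have hneg := tendstoInMeasure_const_mul hrem (neg_ne_zero.2 (inv_ne_zero hs0.ne'))
    refine hneg.congr (fun N => ae_of_all _ fun ω => ?_) (ae_of_all _ fun ω => by simp)
    dsimp only [Pi.sub_apply]
    rcases Nat.eq_zero_or_pos N with rfl | hN
    · simp
    · rw [sqrt_mul_sub_eq hJ hN _ b, ← Finset.sum_div]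
      ring
  have hKm : ∀ N : ℕ, AEMeasurable (fun ω =>
      s ^ 2 * (quadRatio J (betweenMS N (fun i => X i ω) / withinMS N (fun i => X i ω) - 1) /
        withinMS N (fun i => X i ω) ^ 2)) P := fun N =>
    ((measurable_quadRatio.comp_aemeasurable (((aemeasurable_betweenMS hXm N).div
      (aemeasurable_withinMS hXm N)).sub_const 1)).div
        ((aemeasurable_withinMS hXm N).pow_const 2)).const_mul _
  have hK : TendstoInMeasure P (fun (N : ℕ) ω =>
      s ^ 2 * (quadRatio J (betweenMS N (fun i => X i ω) / withinMS N (fun i => X i ω) - 1) /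
        withinMS N (fun i => X i ω) ^ 2)) atTop (fun _ => 1) := by
    refine tendstoInMeasure_of_tendsto_ae (fun N => (hKm N).aestronglyMeasurable) ?_
    filter_upwards [ae_tendsto_meanSquares hJ hX hind] with ω hω
    have h1 : Tendsto (fun N : ℕ => betweenMS N (fun i => X i ω) / withinMS N (fun i => X i ω) - 1)
        atTop (𝓝 0) := by
      have := (hω.2.div hω.1 hv'.ne').sub_const 1
      rwa [div_self hv'.ne', sub_self] at this
    have h2 := ((tendsto_quadRatio (J := J)).comp h1).div (hω.1.pow 2) (by positivity)
    have h3 := h2.const_mul (s ^ 2)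
    -- The variance in the central limit theorem exactly offsets the curvature `(1 - 1 / J) / 2` of
    -- the log-likelihood ratio.
    have e : s ^ 2 * ((-(1 / 2) / J - -(1 / 2)) / (v : ℝ) ^ 2) = 1 := by
      rw [hs2]
      field_simp
      ring
    rw [e] at h3
    exact h3
  -- Slutsky's lemma, with the continuous map `(w, c) ↦ posSq w * c` and `c → 1`.
  have hfin := hT.continuous_comp_prodMk_of_tendstoInMeasure_const
    (g := fun q : ℝ × ℝ => posSq q.1 * q.2)
    ((continuous_posSq.comp continuous_fst).mul continuous_snd) hK hKm
  refine hfin.congr (fun N => ?_) (ae_of_all _ fun w => by simp)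
  rcases Nat.eq_zero_or_pos N with rfl | hN
  · refine ae_of_all _ fun ω => ?_
    dsimp only
    rw [lrt_zero]
    simp [withinMS]
  · filter_upwards [ae_withinMS_pos hJ hv hX] with ω hω
    rw [lrt_eq_posSq hJ hN (hω N hN), div_eq_inv_mul, posSq_smul (inv_pos.2 hs0)]
    field_simp

end Asymptotics

/-! ### The limit law -/

lemma chiSq_zero : chiSq 0 = Measure.dirac 0 := by
  simp only [chiSq, Finset.univ_eq_empty, Finset.sum_empty]
  rw [Measure.map_const]
  simp

lemma chiSq_one : chiSq 1 = (gaussianReal 0 1).map (fun z => z ^ 2) := by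
  have h := (measurePreserving_eval (fun _ : Fin 1 => gaussianReal 0 1) 0).map_eq
  rw [← h, chiSq, Measure.map_map (g := fun z : ℝ => z ^ 2) (by fun_prop) (measurable_pi_apply 0)]
  congr 1
  ext z
  simp

/-- The law of `w² 1{w ≥ 0}`, `w` standard normal, is a mixture of `χ²` distributions. -/
theorem map_posSq_gaussianReal : (gaussianReal 0 1).map posSq =
    (1 / 2 : ℝ≥0∞) • chiSq 0 + (1 / 2 : ℝ≥0∞) • chiSq 1 := by
  set μ := gaussianReal 0 1 with hμ
  have hneg : μ.map (fun x => -x) = μ := by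
    rw [hμ, gaussianReal_map_neg, neg_zero]
  have hsymm : ∀ A : Set ℝ, MeasurableSet A → μ ((fun x => -x) ⁻¹' A) = μ A := fun A hA => by
    conv_rhs => rw [← hneg]
    rw [Measure.map_apply measurable_neg hA]
  have hIic : μ (Iio 0) = μ (Ioi 0) := by
    rw [← hsymm _ measurableSet_Ioi]
    congr 1
    ext x
    simp
  have h0 : μ {0} = 0 := (nullSingletonClass_gaussianReal one_ne_zero).measure_singleton 0
  have hsplit : ∀ A : Set ℝ, MeasurableSet A → μ A = μ (A ∩ Ioi 0) + μ (A ∩ Iio 0) :=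
    fun A hA => by
      have h1 : μ (A \ Ioi 0) = μ (A ∩ Iio 0) := by
        refine measure_congr ?_
        filter_upwards [measure_eq_zero_iff_ae_notMem.1 h0] with x hx
        rw [eq_iff_iff]
        change (x ∈ A ∧ ¬ 0 < x) ↔ (x ∈ A ∧ x < 0)
        rw [not_lt]
        exact and_congr_right fun _ => ⟨fun h => h.lt_of_ne hx, le_of_lt⟩
      rw [← h1, measure_inter_add_sdiff _ measurableSet_Ioi]
  -- Applied to the whole line this gives the weight of the atom at `0`; applied to preimages under
  -- squaring it gives the `χ²` part, since there `posSq` agrees with the square on `Ioi 0`.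
  have hhalf : ∀ A : Set ℝ, MeasurableSet A → (fun x => -x) ⁻¹' A = A →
      μ (A ∩ Ioi 0) = 1 / 2 * μ A := fun A hA hAs => by
    have h2 : μ (A ∩ Iio 0) = μ (A ∩ Ioi 0) := by
      rw [← hsymm _ (hA.inter measurableSet_Ioi), preimage_inter, hAs]
      congr 2
      ext x
      simp
    rw [hsplit A hA, h2, ← two_mul, ← mul_assoc, one_div, ENNReal.inv_mul_cancel (by simp) (by simp),
      one_mul]
  ext B hB
  rw [Measure.map_apply continuous_posSq.measurable hB, chiSq_zero, chiSq_one]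
  simp only [Measure.coe_add, Measure.coe_smul, Pi.add_apply, Pi.smul_apply, smul_eq_mul]
  rw [Measure.map_apply (by fun_prop) hB, Measure.dirac_apply' _ hB,
    hsplit _ (continuous_posSq.measurable hB), add_comm,
    ← hhalf _ ((by fun_prop : Measurable fun z : ℝ => z ^ 2) hB) (by ext x; simp)]
  congr 1
  · have h3 : posSq ⁻¹' B ∩ Iio 0 = {x | (0 : ℝ) ∈ B} ∩ Iio 0 := by
      ext x
      refine and_congr_left fun hx : x < 0 => ?_
      simp [posSq, not_le.2 hx]
    have h4 : μ (Iio 0) = 1 / 2 := by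
      have := hhalf univ MeasurableSet.univ preimage_univ
      rwa [univ_inter, measure_univ, mul_one, ← hIic] at this
    rw [h3]
    by_cases hB0 : (0 : ℝ) ∈ B
    · simp [hB0, h4]
    · simp [hB0]
  · congr 1
    ext x
    refine and_congr_left fun hx : 0 < x => ?_
    simp [posSq, hx.le]

/-- A sequence with limit `posSq` under the standard normal law has limit `limitStat`. -/
lemma tendstoInDistribution_limitStat (hJ : 2 ≤ J) {v : ℝ≥0} (hv : 0 < v) (b : ℝ) {Ω : Type*}
    [MeasurableSpace Ω] {P : Measure Ω} [IsProbabilityMeasure P] {Y : ℕ → Ω → ℝ}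
    (h : TendstoInDistribution Y atTop posSq (fun _ => P) (gaussianReal 0 1)) :
    TendstoInDistribution Y atTop (limitStat (param ((v : ℝ) • (1 : Matrix (Fin J) (Fin J) ℝ)) b))
      (fun _ => P) (stdGaussian (Param J)) := by
  have hfun : limitStat (param ((v : ℝ) • (1 : Matrix (Fin J) (Fin J) ℝ)) b) =
      posSq ∘ fun z => ⟪dirV J, z⟫ := funext fun z => limitStat_eq hJ hv b z
  have hm : Measurable fun z : Param J => ⟪dirV J, z⟫ := by fun_prop
  rw [hfun]
  refine ⟨h.forall_aemeasurable, (continuous_posSq.measurable.comp hm).aemeasurable, ?_⟩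
  -- Convergence in distribution depends on the limit only through its law, so equality of the two
  -- laws suffices.
  have hmap : (stdGaussian (Param J)).map (posSq ∘ fun z => ⟪dirV J, z⟫) =
      (gaussianReal 0 1).map posSq := by
    rw [← Measure.map_map continuous_posSq.measurable hm, map_inner_stdGaussian (norm_dirV hJ)]
  convert h.tendsto using 2
  exact congrArg 𝓝 (Subtype.ext hmap)

end RandomEffects

theorem mainTheorem3 {J : ℕ} (hJ : 2 ≤ J) (β : ℝ) (σ₂sq : ℝ≥0) (hσ : 0 < σ₂sq)
    {Ω : Type*} [MeasurableSpace Ω] (P : Measure Ω) [IsProbabilityMeasure P]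
    (X : ℕ → Ω → RandomEffects.Obs J)
    (hXlaw : ∀ i, HasLaw (X i) (RandomEffects.reLaw J β 0 σ₂sq) P)
    (hXindep : iIndepFun X P)
    (θ : RandomEffects.Param J)
    (hθ : θ = RandomEffects.param ((σ₂sq : ℝ) • (1 : Matrix (Fin J) (Fin J) ℝ)) β) :
    -- the random effects model is the submodel `Θ₁` of the saturated Gaussian model
    (∀ (b : ℝ) (v₁ v₂ : ℝ≥0), 0 < v₂ →
      RandomEffects.reLaw J b v₁ v₂ =
        RandomEffects.model (RandomEffects.param (RandomEffects.reCov J v₁ v₂) b)) ∧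
    (∀ η ∈ RandomEffects.Theta J, RandomEffects.model η =
      volume.withDensity (fun x => ENNReal.ofReal (RandomEffects.density η x))) ∧
    θ ∈ RandomEffects.Theta0 J ∧
    RandomEffects.Theta0 J ⊆ RandomEffects.Theta1 J ∧
    RandomEffects.Theta1 J ⊆ RandomEffects.Theta J ∧
    -- the true parameter is interior to `Θ`, and the Fisher information is invertible there
    θ ∈ interior (RandomEffects.Theta J) ∧
    (RandomEffects.fisher θ).PosDef ∧
    -- the tangent cones
    RandomEffects.tangentCone (RandomEffects.Theta0 J) θ =
      {τ | ∃ b₀ b₂ : ℝ,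
        τ = RandomEffects.param (b₂ • (1 : Matrix (Fin J) (Fin J) ℝ)) b₀} ∧
    RandomEffects.tangentCone (RandomEffects.Theta1 J) θ =
      {τ | ∃ b₀ b₁ b₂ : ℝ, 0 ≤ b₁ ∧ τ = RandomEffects.param (RandomEffects.reCov J b₁ b₂) b₀} ∧
    RandomEffects.tangentCone (RandomEffects.Theta0 J) θ =
      (RandomEffects.nullSpan J : Set (RandomEffects.Param J)) ∧
    Module.finrank ℝ (RandomEffects.nullSpan J) = 2 ∧
    RandomEffects.tangentCone (RandomEffects.Theta1 J) θ =
      {τ | ∃ α₀ α₁ α₂ : ℝ, 0 ≤ α₁ ∧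
        τ = α₀ • RandomEffects.c0 J + α₁ • RandomEffects.c1 J + α₂ • RandomEffects.c2 J} ∧
    LinearIndependent ℝ ![RandomEffects.c0 J, RandomEffects.c1 J, RandomEffects.c2 J] ∧
    -- the suprema in the likelihood ratio statistic are almost surely finite
    (∀ N : ℕ, 0 < N → ∀ᵐ ω ∂P,
      BddAbove (RandomEffects.logLik N (fun i => X i ω) '' RandomEffects.Theta1 J)) ∧
    -- the likelihood ratio statistic converges to the difference of two minimal squared distances
    TendstoInDistribution (fun (N : ℕ) ω => RandomEffects.lrt N (fun i => X i ω)) atTop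
      (RandomEffects.limitStat θ) (fun _ => P) (stdGaussian (RandomEffects.Param J)) ∧
    -- the minima exist, and their difference has a closed form
    (∀ z : RandomEffects.Param J,
      (∃ m₀, IsLeast (RandomEffects.sqDists θ
        (RandomEffects.tangentCone (RandomEffects.Theta0 J) θ) z) m₀) ∧
      (∃ m₁, IsLeast (RandomEffects.sqDists θ
        (RandomEffects.tangentCone (RandomEffects.Theta1 J) θ) z) m₁) ∧
      RandomEffects.limitStat θ z = RandomEffects.posSq ⟪RandomEffects.dirV J, z⟫) ∧
    RandomEffects.residual J ≠ 0 ∧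
    (stdGaussian (RandomEffects.Param J)).map (fun z => ⟪RandomEffects.dirV J, z⟫) =
      gaussianReal 0 1 ∧
    -- the limit law
    TendstoInDistribution (fun (N : ℕ) ω => RandomEffects.lrt N (fun i => X i ω)) atTop
      RandomEffects.posSq (fun _ => P) (gaussianReal 0 1) ∧
    (gaussianReal 0 1).map RandomEffects.posSq =
      (1 / 2 : ℝ≥0∞) • RandomEffects.chiSq 0 + (1 / 2 : ℝ≥0∞) • RandomEffects.chiSq 1 := by
  subst hθ
  have hJ0 : 0 < J := by omega
  have hσ' : (0 : ℝ) < σ₂sq := NNReal.coe_pos.2 hσ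
  have hlrt := RandomEffects.tendstoInDistribution_lrt hJ hσ hXlaw hXindep
  refine ⟨fun b v₁ v₂ _ => RandomEffects.reLaw_eq_model b v₁ v₂,
    fun η hη => RandomEffects.model_eq_withDensity hη, ⟨_, _, hσ', rfl⟩,
    RandomEffects.theta0_subset_theta1, RandomEffects.theta1_subset_theta,
    RandomEffects.mem_interior_theta hσ' β, RandomEffects.posDef_fisher hJ0 hσ β, ?_, ?_,
    RandomEffects.tangentCone_theta0 hσ' β, RandomEffects.finrank_nullSpan hJ,
    RandomEffects.tangentCone_theta1 hJ hσ' β, RandomEffects.linearIndependent_c hJ,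
    fun N hN => ?_, RandomEffects.tendstoInDistribution_limitStat hJ hσ β hlrt,
    fun z => ⟨⟨_, RandomEffects.isLeast_sqDists_theta0 hJ0 hσ β z⟩,
      ⟨_, RandomEffects.isLeast_sqDists_theta1 hJ hσ β z⟩, RandomEffects.limitStat_eq hJ hσ β z⟩,
    ?_, RandomEffects.map_inner_stdGaussian (RandomEffects.norm_dirV hJ), hlrt,
    RandomEffects.map_posSq_gaussianReal⟩
  · rw [RandomEffects.tangentCone_theta0 hσ' β]
    ext τ
    exact RandomEffects.mem_nullSpan_iff
  · rw [RandomEffects.tangentCone_theta1 hJ hσ' β]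
    ext τ
    simp only [RandomEffects.altCone, RandomEffects.combination_eq_param]
  · filter_upwards [RandomEffects.ae_withinMS_pos hJ hσ hXlaw] with ω hω
    exact (RandomEffects.isGreatest_logLik_theta1 hJ hN (hω N hN)).bddAbove
  · rw [RandomEffects.residual_eq]
    exact RandomEffects.offDir_ne_zero hJ
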